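/- **Setting.** Let $Y$ be a closed oriented Riemannian $3$-manifold with a spin$^c$ structure $P\to Y$ (structure group $\mathrm{Spin}^c(3)=U(2)$) and let $A$ be a connection on $P$ (for instance the one induced by the Levi-Civita connection and a connection on the determinant line bundle). Let $S=\mathrm{Hom}(\mathbf C\otimes\mathrm{Im}\,\mathbf H,\mathbf H)\cong \mathrm{Hom}(\mathbf C^3,\mathbf C^2)$ with the real inner product $\mathrm{Re}\,\mathrm{tr}(\alpha\beta^*)$, the hyperkähler structure $I,J,K$ given by the complex linear Clifford action of $\mathrm{Im}\,\mathbf H$ on $\mathbf H\cong\mathbf C^2$, the $U(1)$-action by complex scalars, the moment map $\mu(\psi)=\psi\psi^*-\frac12|\psi|^2\mathrm{id}$, the Clifford multiplication $c:S\to\mathbf H$, $c(\psi)=\sum_j e_j\psi(e_j)$, and the embedding $\iota:\mathbf H\to S$, $\iota(s)(e_j)=e_js$, where $(e_1,e_2,e_3)=(I,J,K)$. Put $$M^\mu=\mu^{-1}(0)\setminus\{0\},\quad W^\mu=\ker c\cap M^\mu,\quad M_0=M^\mu/U(1),\quad W_0=W^\mu/U(1),$$ let $\tau:M^\mu\to M_0$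 be the quotient map, let $\mathcal L\subset TM^\mu$ be the tangent line field of the $U(1)$-orbits, let $\mathcal N=TM^\mu|_{W^\mu}\cap\iota(\mathbf H)$, and let $\mathcal T_0$ be the orthogonal complement of $\tau_*\mathcal N$ in $TM_0|_{W_0}$. $\mathrm{Spin}^c(3)$ acts on all of these through $\psi\mapsto u\circ\psi\circ\xi(u)^{-1}$, where $\xi:\mathrm{Spin}^c(3)\to SO(3)$ is the canonical homomorphism. Let $\mathbb M_0$, $\mathbb W_0$, $\mathbb T_0$ be the bundles associated with $P$ and $M_0$, $W_0$, $\mathcal T_0$, and let $p_0:\mathcal V\mathbb M_0|_{\mathbb W_0}\to\mathbb T_0$ be the orthogonal projection from the vertical tangent bundle. For a section $\phi$ of $\mathbb W_0$ let $\mathfrak F_A\phi=\sum_j\gamma(e_j)\nabla_{e_j}\phi$ be the Fueter operator of $\mathbb M_0$, where $(e_j)$ is now a local oriented orthonormal frame of $TY$, $\gamma$ is the Clifford action on $\mathcal V\mathbb M_0$ and $\nabla$ is the covariant derivative induced by $A$. Let $\mathfrak Q_A\phi=p_0(\mathfrak F_A\phi)$ be the $3/2$-Fueter operator, and let $D^\phi=\sum_j\gamma(e_j)\nabla^\phi_{e_j}$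 be the Dirac operator on $\phi^*\mathcal V\mathbb M_0$, where $\nabla^\phi$ is the connection induced by $A$ and the Levi-Civita connection of the fibres. **Theorem.** For every smooth section $\phi$ of $\mathbb W_0$ the operator $$p_0\circ D^\phi:\Gamma(Y,\phi^*\mathcal V\mathbb W_0)\to\Gamma(Y,\phi^*\mathbb T_0)$$ is a first order linear differential operator whose principal symbol $$\sigma_\xi:(\phi^*\mathcal V\mathbb W_0)_y\to(\phi^*\mathbb T_0)_y$$ is injective for all $y\in Y$ and all $0\ne\xi\in T_y^*Y$. The linearization of $\mathfrak Q_A$ at $\phi$, that is, the operator that maps the velocity at $t=0$ of a smooth family $\phi_t$ of sections of $\mathbb W_0$ with $\phi_0=\phi$ to the $\mathbb T_0$-component of the covariant $t$-derivative of $\mathfrak Q_A\phi_t$ at $t=0$, is well defined and differs from $p_0\circ D^\phi$ by a term of order zero, so it is of first order with the same injective principal symbol. Moreover, $\mathrm{rank}\,\phi^*\mathcal V\mathbb W_0<\mathrm{rank}\,\phi^*\mathbb T_0$. Hence $\mathfrak Q_A$ is an overdetermined elliptic operator. -/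

import Mathlib

open scoped Manifold ContDiff Matrix InnerProductSpace

noncomputable section

namespace ThreeHalfFueter

/-! ### The linear algebra of `Hom(ℂ ⊗ Im ℍ, ℍ)` -/

/-- The space `S = Hom(ℂ ⊗ Im ℍ, ℍ) = Hom(ℂ³, ℂ²)` of complex `2 × 3` matrices, with real inner
product `Re tr (A Bᴴ)` (the factor `1/2` sometimes put in front plays no role). The column `j` of a
matrix is the value on the `j`-th element of the basis `I, J, K` of `Im ℍ`. -/
abbrev TSpinor : Type := EuclideanSpace ℂ (Fin 2 × Fin 3)

/-- The entries of an element of `S`, as a matrix. -/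
def toMat : TSpinor ≃ₗ[ℂ] Matrix (Fin 2) (Fin 3) ℂ :=
  (WithLp.linearEquiv 2 ℂ (Fin 2 × Fin 3 → ℂ)).trans (LinearEquiv.curry ℂ ℂ (Fin 2) (Fin 3))

/-- The imaginary unit quaternions `I, J, K` acting complex linearly on `ℍ = ℂ²`. -/
def quat : Fin 3 → Matrix (Fin 2) (Fin 2) ℂ :=
  ![!![Complex.I, 0; 0, -Complex.I], !![0, 1; -1, 0], !![0, Complex.I; Complex.I, 0]]

/-- The (hyperkähler, or Clifford) action of `I, J, K` on `S`, through the factor `ℍ`. -/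
def cliff (j : Fin 3) (ψ : TSpinor) : TSpinor := toMat.symm (quat j * toMat ψ)

/-- The Clifford multiplication `c : Hom(ℂ ⊗ Im ℍ, ℍ) → ℍ`, `ψ ↦ ∑ⱼ eⱼ · ψ(eⱼ)`. -/
def cliffMul : TSpinor →ₗ[ℝ] (Fin 2 → ℂ) where
  toFun ψ := ∑ j, quat j *ᵥ (toMat ψ).col j
  map_add' ψ χ := by
    rw [← Finset.sum_add_distrib]
    refine Finset.sum_congr rfl fun j _ => ?_
    rw [← Matrix.mulVec_add]
    congr 1
  map_smul' r ψ := by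
    rw [Finset.smul_sum]
    refine Finset.sum_congr rfl fun j _ => ?_
    rw [← Matrix.mulVec_smul]
    congr 1

/-- The embedding `ι : ℍ → Hom(ℂ ⊗ Im ℍ, ℍ)`, `ι(s) = I* ⊗ Is + J* ⊗ Js + K* ⊗ Ks`. -/
def iota : (Fin 2 → ℂ) →ₗ[ℝ] TSpinor where
  toFun s := toMat.symm (Matrix.of fun i j => (quat j *ᵥ s) i)
  map_add' s t := by
    rw [← map_add]
    congr 1
    ext i j
    simp [Matrix.mulVec_add]
  map_smul' r s := by
    have h : ∀ M : Matrix (Fin 2) (Fin 3) ℂ, r • toMat.symm M = toMat.symm ((r : ℂ) • M) :=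
      fun M => by
        rw [map_smul]
        rfl
    rw [RingHom.id_apply, h]
    congr 1
    ext i j
    simp only [Matrix.mulVec_smul, Matrix.of_apply, Matrix.smul_apply, Pi.smul_apply]
    rfl

/-- The quadratic `U(1)`-moment map `μ(ψ) = ψ ψ* - (1/2) |ψ|² id`. -/
def moment (ψ : TSpinor) : Matrix (Fin 2) (Fin 2) ℂ :=
  toMat ψ * (toMat ψ)ᴴ - ((1 / 2 : ℂ) * (toMat ψ * (toMat ψ)ᴴ).trace) • (1 : Matrix _ _ ℂ)

/-- The differential of the moment map at `w`,
`d_w μ(h) = w h* + h w* - (1/2) tr (w h* + h w*) id`. -/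
def dMoment (w : TSpinor) : TSpinor →ₗ[ℝ] Matrix (Fin 2) (Fin 2) ℂ where
  toFun h := (toMat w * (toMat h)ᴴ + toMat h * (toMat w)ᴴ)
    - ((1 / 2 : ℂ) * (toMat w * (toMat h)ᴴ + toMat h * (toMat w)ᴴ).trace) • (1 : Matrix _ _ ℂ)
  map_add' h k := by
    simp only [map_add, Matrix.conjTranspose_add, Matrix.mul_add, Matrix.add_mul,
      Matrix.trace_add, mul_add, add_smul]
    abel
  map_smul' r h := by
    have hr : toMat (r • h) = (r : ℂ) • toMat h := by
      rw [← map_smul]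
      congr 1
    have h2 : ∀ X : Matrix (Fin 2) (Fin 2) ℂ, r • X = (r : ℂ) • X := fun X => by
      ext i j
      simp
    simp only [hr, h2, Matrix.conjTranspose_smul, Matrix.mul_smul, Matrix.smul_mul,
      Matrix.trace_add, Matrix.trace_smul, RCLike.star_def, Complex.conj_ofReal, smul_sub,
      smul_add, smul_smul, smul_eq_mul, RingHom.id_apply, mul_add]
    congr 3 <;> ring

/-! ### The spaces `M^μ`, `W^μ`, `M₀`, `W₀` and their tangent spaces -/

/-- `M^μ = μ⁻¹(0) \ {0}`. -/
def Mmu : Set TSpinor := {ψ | moment ψ = 0 ∧ ψ ≠ 0}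

/-- `W^μ = W ∩ M^μ`, where `W = ker c` is the space of `3/2`-spinors. -/
def Wmu : Set TSpinor := {ψ | cliffMul ψ = 0 ∧ ψ ∈ Mmu}

/-- The quotient of `S` by the action of `U(1)` by complex scalars. -/
abbrev Orbits : Type := MulAction.orbitRel.Quotient Circle TSpinor

/-- The quotient map `τ`. -/
def tau (ψ : TSpinor) : Orbits := Quotient.mk _ ψ

/-- The hyperkähler quotient `M₀ = M^μ / U(1)`. -/
def M0 : Set Orbits := tau '' Mmu

/-- `W₀ = W^μ / U(1) ⊆ M₀`. -/
def W0 : Set Orbits := tau '' Wmu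

/-- The line `𝓛_w` tangent to the `U(1)`-orbit of `w`. -/
def lineL (w : TSpinor) : Submodule ℝ TSpinor := Submodule.span ℝ {Complex.I • w}

/-- The tangent space `T_w M^μ` (`0` is a regular value of `μ` away from the origin). -/
def tangentMmu (w : TSpinor) : Submodule ℝ TSpinor := LinearMap.ker (dMoment w)

/-- The tangent space `T_w W^μ` (`0` is a regular value of `μ` on `W`, away from the origin). -/
def tangentWmu (w : TSpinor) : Submodule ℝ TSpinor := LinearMap.ker cliffMul ⊓ tangentMmu w

/-- The horizontal space at `w ∈ M^μ`: the orthogonal complement of `𝓛_w` in `T_w M^μ`. The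
differential of `τ` identifies it isometrically, and compatibly with `I, J, K`, with the tangent
space of `M₀` at `τ w`. Tangent vectors of `M₀` are represented by their horizontal lifts. -/
def horizontal (w : TSpinor) : Submodule ℝ TSpinor := tangentMmu w ⊓ (lineL w)ᗮ

/-- The horizontal lift at `w ∈ W^μ` of the tangent space of `W₀` at `τ w`. -/
def tangentW0 (w : TSpinor) : Submodule ℝ TSpinor := tangentWmu w ⊓ (lineL w)ᗮ

/-- The space `𝓝_w = T_w M^μ ∩ ι(ℍ)`. -/
def normalN (w : TSpinor) : Submodule ℝ TSpinor := tangentMmu w ⊓ LinearMap.range iota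

/-- The space `𝓣_w`, the orthogonal complement of `𝓝_w ⊕ 𝓛_w` in `T_w M^μ`. It is the horizontal
lift of `𝓣₀`, the orthogonal complement of `τ_* 𝓝` in the tangent space of `M₀`. -/
def calT (w : TSpinor) : Submodule ℝ TSpinor := tangentMmu w ⊓ (normalN w ⊔ lineL w)ᗮ

/-- The orthogonal projection onto the tangent space of `M₀`. -/
def projH (w : TSpinor) : TSpinor →L[ℝ] TSpinor := (horizontal w).starProjection

/-- The orthogonal projection `p₀` onto `𝓣₀`. -/
def projT (w : TSpinor) : TSpinor →L[ℝ] TSpinor := (calT w).starProjection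

/-- The Levi-Civita covariant derivative of `M₀` along a path, in terms of lifts. If `w` is the
value and `w'` the velocity of a path in `M^μ`, and `h`, `h'` are the value and the derivative of a
field of horizontal vectors along it, then this is the horizontal lift of the covariant derivative
along the path `τ w` in `M₀` of the field represented by `h`: rotate the path by a `U(1)`-valued
function so that its velocity becomes horizontal, rotate the field accordingly, differentiate
in `S`, and project onto the horizontal space. -/
def leviCivita (w w' h h' : TSpinor) : TSpinor :=
  projH w (h' - (⟪Complex.I • w, w'⟫_ℝ / ‖w‖ ^ 2) • (Complex.I • h))

/-! ### The group `Spin^c(3) = U(2)` -/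

/-- The group `Spin^c(3) = (SU(2) × U(1)) / ±1 = U(2)`. -/
abbrev SpinC3 : Type := Matrix.unitaryGroup (Fin 2) ℂ

/-- The homomorphism `ξ : Spin^c(3) → SO(3)`, given by `u eⱼ u⁻¹ = ∑ᵢ ξ(u)ᵢⱼ eᵢ`. -/
def covering (u : SpinC3) : Matrix (Fin 3) (Fin 3) ℝ :=
  Matrix.of fun i j => -(1 / 2) *
    (quat i * ((u : Matrix (Fin 2) (Fin 2) ℂ) * quat j * (u : Matrix (Fin 2) (Fin 2) ℂ)ᴴ)).trace.re

/-- The derivative `𝔲(2) → 𝔰𝔬(3)` of `ξ`, given by `[X, eⱼ] = ∑ᵢ ξ_*(X)ᵢⱼ eᵢ`. -/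
def dCovering (X : Matrix (Fin 2) (Fin 2) ℂ) : Matrix (Fin 3) (Fin 3) ℝ :=
  Matrix.of fun i j => -(1 / 2) * (quat i * (X * quat j - quat j * X)).trace.re

/-- The diagonal action of `Spin^c(3)` on `S = Hom(ℂ ⊗ Im ℍ, ℍ)`, `ψ ↦ u ∘ ψ ∘ ξ(u)⁻¹`. -/
def act (u : SpinC3) (ψ : TSpinor) : TSpinor :=
  toMat.symm ((u : Matrix (Fin 2) (Fin 2) ℂ) * toMat ψ * ((covering u).map Complex.ofReal)ᵀ)

/-- The infinitesimal action of `𝔲(2)` on `S`. -/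
def infAct (X : Matrix (Fin 2) (Fin 2) ℂ) (ψ : TSpinor) : TSpinor :=
  toMat.symm (X * toMat ψ + toMat ψ * ((dCovering X).map Complex.ofReal)ᵀ)

/-- The action of `Spin^c(3)` on the quotient of `S` by `U(1)`. -/
def actOrbits (u : SpinC3) : Orbits → Orbits :=
  Quotient.map (act u) (by
    rintro ψ χ ⟨z, rfl⟩
    refine ⟨z, ?_⟩
    have h : ∀ χ : TSpinor, z • χ = (z : ℂ) • χ := fun _ => rfl
    simp only [h, act, map_smul, Matrix.mul_smul, Matrix.smul_mul])

/-! ### Spin^c structures, connections and sections -/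

/-- The model space of a `3`-manifold. -/
abbrev E3 : Type := EuclideanSpace ℝ (Fin 3)

section Manifold

variable {Y : Type*} [TopologicalSpace Y] [ChartedSpace E3 Y] [IsManifold 𝓘(ℝ, E3) ∞ Y]

/-- A spin^c structure on the oriented Riemannian `3`-manifold `(Y, g)`, that is, a principal
`Spin^c(3)`-bundle `P` with an equivariant map to the bundle of oriented orthonormal frames,
in terms of local trivializations: an open cover `(U a)`, smooth transition functions
`trans a b : U a ∩ U b → Spin^c(3)` that form a cocycle, and orthonormal frames on the sets `U a`,
with values in the orientation of `Y`, that are related by `ξ (trans a b)`. (These frames are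
related by elements of `SO(3)`, so they determine the orientation.) -/
structure SpinCStructure
    (g : Bundle.ContMDiffRiemannianMetric 𝓘(ℝ, E3) ∞ E3 (TangentSpace 𝓘(ℝ, E3) : Y → Type _))
    (ι : Type*) where
  U : ι → Set Y
  isOpen : ∀ a, IsOpen (U a)
  cover : ∀ y, ∃ a, y ∈ U a
  frame : ι → Fin 3 → ∀ y : Y, TangentSpace 𝓘(ℝ, E3) y
  frame_smooth : ∀ a j, ContMDiffOn 𝓘(ℝ, E3) (𝓘(ℝ, E3).prod 𝓘(ℝ, E3)) ∞
    (fun y => (⟨y, frame a j y⟩ : TangentBundle 𝓘(ℝ, E3) Y)) (U a)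
  frame_orthonormal : ∀ a, ∀ y ∈ U a, ∀ i j,
    g.inner y (frame a i y) (frame a j y) = if i = j then 1 else 0
  trans : ι → ι → Y → SpinC3
  trans_smooth : ∀ a b i j, ContMDiffOn 𝓘(ℝ, E3) 𝓘(ℝ, ℂ) ∞
    (fun y => (trans a b y : Matrix (Fin 2) (Fin 2) ℂ) i j) (U a ∩ U b)
  cocycle : ∀ a b c, ∀ y ∈ U a ∩ U b ∩ U c, trans a b y * trans b c y = trans a c y
  frame_trans : ∀ a b, ∀ y ∈ U a ∩ U b, ∀ j,
    frame b j y = ∑ i, covering (trans a b y) i j • frame a i y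

variable {g : Bundle.ContMDiffRiemannianMetric 𝓘(ℝ, E3) ∞ E3
  (TangentSpace 𝓘(ℝ, E3) : Y → Type _)} {ι : Type*}

/-- A connection on the principal `Spin^c(3)`-bundle: in every local trivialization a smooth
`𝔲(2)`-valued `1`-form, with the usual transformation law
`A_b = u⁻¹ A_a u + u⁻¹ du`, where `u = trans a b`. -/
structure PrincipalConnection (P : SpinCStructure g ι) where
  form : ι → ∀ y : Y, TangentSpace 𝓘(ℝ, E3) y →ₗ[ℝ] Matrix (Fin 2) (Fin 2) ℂ
  skew : ∀ a, ∀ y ∈ P.U a, ∀ X, (form a y X)ᴴ = -form a y X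
  smooth : ∀ a k i j, ContMDiffOn 𝓘(ℝ, E3) 𝓘(ℝ, ℂ) ∞
    (fun y => form a y (P.frame a k y) i j) (P.U a)
  form_trans : ∀ a b, ∀ y ∈ P.U a ∩ P.U b, ∀ X : TangentSpace 𝓘(ℝ, E3) y,
    form b y X = (P.trans a b y : Matrix (Fin 2) (Fin 2) ℂ)ᴴ *
      (form a y X * (P.trans a b y : Matrix (Fin 2) (Fin 2) ℂ) +
        Matrix.of fun i j => (mfderiv 𝓘(ℝ, E3) 𝓘(ℝ, ℂ)
          (fun z => (P.trans a b z : Matrix (Fin 2) (Fin 2) ℂ) i j) y X : ℂ))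

/-- `w` is a smooth map from the open set `V` to `W^μ` that lifts the map `φ` from `V` to `W₀`. -/
structure IsLift (φ : Y → Orbits) (V : Set Y) (w : Y → TSpinor) : Prop where
  isOpen : IsOpen V
  smooth : ContMDiffOn 𝓘(ℝ, E3) 𝓘(ℝ, TSpinor) ∞ w V
  mem : ∀ y ∈ V, w y ∈ Wmu
  lift : ∀ y ∈ V, tau (w y) = φ y

/-- A smooth section of the bundle `𝕎₀ = P ×_{Spin^c(3)} W₀`: in every local trivialization a map
to `W₀` that is smooth, which means that locally it lifts to a smooth map to `W^μ`. -/
structure SectionW0 (P : SpinCStructure g ι) where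
  toFun : ι → Y → Orbits
  mem : ∀ a, ∀ y ∈ P.U a, toFun a y ∈ W0
  smooth : ∀ a, ∀ y ∈ P.U a, ∃ V w, y ∈ V ∧ V ⊆ P.U a ∧ IsLift (toFun a) V w
  compat : ∀ a b, ∀ y ∈ P.U a ∩ P.U b, toFun a y = actOrbits (P.trans a b y) (toFun b y)

/-- A smooth section over `V` of `φ^*𝒱𝕎₀`, the pull-back of the vertical tangent bundle of `𝕎₀`, in
a local trivialization in which the section `φ` of `𝕎₀` is lifted to the map `w` to `W^μ`; its
values are given by their horizontal lifts at the points `w y`. -/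
structure IsVerticalSection (V : Set Y) (w v : Y → TSpinor) : Prop where
  smooth : ContMDiffOn 𝓘(ℝ, E3) 𝓘(ℝ, TSpinor) ∞ v V
  mem : ∀ y ∈ V, v y ∈ tangentW0 (w y)

/-! ### The operators -/

/-- The covariant derivative `dw(X) + A(X) · w` of an `S`-valued map in the trivialization `a`. -/
def nabla {P : SpinCStructure g ι} (A : PrincipalConnection P) (a : ι) (w : Y → TSpinor) (y : Y)
    (X : TangentSpace 𝓘(ℝ, E3) y) : TSpinor :=
  let dwX : TSpinor := mfderiv 𝓘(ℝ, E3) 𝓘(ℝ, TSpinor) w y X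
  dwX + infAct (A.form a y X) (w y)

/-- The Fueter operator `𝔉_A φ = ∑ⱼ γ(eⱼ) ∇_{eⱼ} φ` of the hyperkähler bundle `𝕄₀`, where `w` is a
lift of `φ`. The covariant derivative of `φ` is represented by the horizontal part of that
of `w`. -/
def fueter {P : SpinCStructure g ι} (A : PrincipalConnection P) (a : ι) (w : Y → TSpinor) (y : Y) :
    TSpinor :=
  ∑ j, cliff j (projH (w y) (nabla A a w y (P.frame a j y)))

/-- The `3/2`-Fueter operator `𝔔_A φ = p₀ (𝔉_A φ)`, where `w` is a lift of `φ`. -/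
def threeHalfFueter {P : SpinCStructure g ι} (A : PrincipalConnection P) (a : ι)
    (w : Y → TSpinor) (y : Y) : TSpinor :=
  projT (w y) (fueter A a w y)

/-- The Dirac operator `D^φ v = ∑ⱼ γ(eⱼ) ∇^φ_{eⱼ} v` of the Clifford module `φ^*𝒱𝕄₀`, where `w` is a
lift of `φ`, and `∇^φ` is the linearization of `∇`, the connection that is induced from the
connection `A` and the Levi-Civita connection of the fibres of `𝕄₀`. -/
def dirac {P : SpinCStructure g ι} (A : PrincipalConnection P) (a : ι) (w v : Y → TSpinor)
    (y : Y) : TSpinor :=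
  ∑ j, cliff j (leviCivita (w y) (nabla A a w y (P.frame a j y))
    (v y) (nabla A a v y (P.frame a j y)))

/-- The operator `p₀ ∘ D^φ : Γ(φ^*𝒱𝕎₀) → Γ(𝕋₀)`. -/
def linearizedFueter {P : SpinCStructure g ι} (A : PrincipalConnection P) (a : ι)
    (w v : Y → TSpinor) (y : Y) : TSpinor :=
  projT (w y) (dirac A a w v y)

/-- `W` is (a lift of) a smooth one-parameter family `φ_t` of sections of `𝕎₀` over `V` with
`φ_0 = φ` (lifted to `w`) and velocity `v = ∂φ_t/∂t` at `t = 0`. -/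
structure IsVariation (V : Set Y) (w v : Y → TSpinor) (W : ℝ → Y → TSpinor) : Prop where
  smooth : ∃ ε > 0, ContMDiffOn (𝓘(ℝ, ℝ).prod 𝓘(ℝ, E3)) 𝓘(ℝ, TSpinor) ∞
    (fun q : ℝ × Y => W q.1 q.2) (Set.Ioo (-ε) ε ×ˢ V) ∧
    ∀ t ∈ Set.Ioo (-ε) ε, ∀ y ∈ V, W t y ∈ Wmu
  zero : ∀ y ∈ V, W 0 y = w y
  velocity : ∀ y ∈ V, projH (w y) (deriv (fun t => W t y) 0) = v y

/-- The linearization of `𝔔_A` along a family `φ_t` lifted to `W`: the covariant derivative of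
`𝔔_A φ_t` at `t = 0`, as a section of `𝕋₀`. -/
def linearizationAlong {P : SpinCStructure g ι} (A : PrincipalConnection P) (a : ι)
    (W : ℝ → Y → TSpinor) (y : Y) : TSpinor :=
  projT (W 0 y) (leviCivita (W 0 y) (deriv (fun t => W t y) 0)
    (threeHalfFueter A a (W 0) y) (deriv (fun t => threeHalfFueter A a (W t) y) 0))

end Manifold

end ThreeHalfFueter

end

noncomputable section

namespace ThreeHalfFueter

/-! ### Coordinates -/

/-! Everything is computed on lifts to `S`, where both projections have explicit formulas. The space
`horizontal w` is the orthogonal complement of the four orthogonal vectors iw, iIw, iJw, iKw, all of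
length |w|, so the projection onto it is `horProj`. For w in `Wmu` the columns w_k have real
hermitian products and satisfy ww* = (|w|²/2) id, so the vectors ι(w_k) lie in 𝓝_w and form a tight
frame of it (`sum_inner_iotaCol`). Subtracting the frame operator, suitably scaled, gives
`calTProj`. These formulas make sense and are differentiable for all w ≠ 0 in `S`, so they can be
differentiated along paths in `Wmu`.

Symbol (`symbol_injective`): if ξ·v is killed by p₀, then ξ·v = ι(s) for some s. Multiplying by ξ
again gives -|ξ|²v = ξ·ι(s). The left side lies in ker c, while |c(ξ·ι(s))| = |ξ||s|; hence s = 0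
and v = 0.

Rank (`tangentW0_lt_calT`): tangent vectors of W₀ are orthogonal to ι(ℍ), hence lie in 𝓣. If the two
spaces were equal, testing with the horizontal parts of the vectors iι(w_k) would force w = 0.

Linearization (`linearization_pointwise`): the velocity of a family of lifts is v + λiw. The product
rule, applied to the projections and to ∇W_t, gives p₀D^φ v plus terms that contain v
undifferentiated. The terms with λ cancel by `U(1)`-equivariance, and the derivative of λ disappears
because `horProj w` kills iw. -/

lemma real_inner_eq (x y : TSpinor) :
    ⟪x, y⟫_ℝ = ∑ p, ((x p).re * (y p).re + (x p).im * (y p).im) := by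
  rw [PiLp.inner_apply]
  refine Finset.sum_congr rfl fun p _ => ?_
  rw [Complex.inner]
  simp only [Complex.mul_re, Complex.conj_re, Complex.conj_im]
  ring

lemma normSq_eq (x : TSpinor) : ‖x‖ ^ 2 = ∑ p, ((x p).re ^ 2 + (x p).im ^ 2) := by
  rw [← real_inner_self_eq_norm_sq, real_inner_eq]
  exact Finset.sum_congr rfl fun p _ => by ring

lemma cliff_apply (j : Fin 3) (ψ : TSpinor) (p : Fin 2 × Fin 3) :
    cliff j ψ p = ∑ l, quat j p.1 l * ψ (l, p.2) := rfl

lemma iota_apply (s : Fin 2 → ℂ) (p : Fin 2 × Fin 3) :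
    iota s p = ∑ l, quat p.2 p.1 l * s l := rfl

lemma cliffMul_apply (ψ : TSpinor) (i : Fin 2) :
    cliffMul ψ i = ∑ j, ∑ l, quat j i l * ψ (l, j) := by
  change (∑ j, quat j *ᵥ (toMat ψ).col j) i = _
  rw [Finset.sum_apply]
  rfl

lemma smul_I_apply (ψ : TSpinor) (p : Fin 2 × Fin 3) :
    (Complex.I • ψ) p = Complex.I * ψ p := rfl

/-- The action of the unit `j` on `S`, as a continuous complex linear map. -/
def cliffL (j : Fin 3) : TSpinor →L[ℂ] TSpinor :=
  LinearMap.toContinuousLinearMap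
    { toFun := cliff j
      map_add' := fun ψ χ => by simp [cliff, Matrix.mul_add]
      map_smul' := fun r ψ => by simp [cliff] }

/-- The embedding `ι` applied to the column `k`. -/
def iotaCol (k : Fin 3) : TSpinor →L[ℂ] TSpinor :=
  LinearMap.toContinuousLinearMap
    { toFun := fun ψ => iota ((toMat ψ).col k)
      map_add' := fun ψ χ => by
        rw [← map_add]; rfl
      map_smul' := fun r ψ => by
        ext p
        simp only [iota_apply, PiLp.smul_apply, smul_eq_mul, RingHom.id_apply, Finset.mul_sum]
        refine Finset.sum_congr rfl fun l _ => ?_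
        simp only [map_smul, Matrix.col, Matrix.transpose_apply, Matrix.smul_apply, smul_eq_mul]
        ring }

lemma iotaCol_apply (k : Fin 3) (ψ : TSpinor) : iotaCol k ψ = iota ((toMat ψ).col k) := rfl

/-- The gradients of the function `|ψ|² / 2` rotated by `i` and of the components of the moment
map: `iψ`, `iIψ`, `iJψ`, `iKψ`. They span the orthogonal complement of `horizontal ψ`. -/
def momentField : Fin 4 → TSpinor →L[ℂ] TSpinor :=
  Fin.cons (Complex.I • ContinuousLinearMap.id ℂ TSpinor) fun j => Complex.I • cliffL j

lemma momentField_zero (ψ : TSpinor) : momentField 0 ψ = Complex.I • ψ := rfl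

lemma momentField_succ (j : Fin 3) (ψ : TSpinor) :
    momentField j.succ ψ = Complex.I • cliff j ψ := rfl

/-! ### Identities -/

lemma inner_I_smul (x y : TSpinor) : ⟪Complex.I • x, y⟫_ℝ = -⟪x, Complex.I • y⟫_ℝ := by
  rw [real_inner_eq, real_inner_eq, ← Finset.sum_neg_distrib]
  refine Finset.sum_congr rfl fun p _ => ?_
  simp


lemma inner_cliff (j : Fin 3) (x y : TSpinor) : ⟪cliff j x, y⟫_ℝ = -⟪x, cliff j y⟫_ℝ := by
  rw [real_inner_eq, real_inner_eq]
  fin_cases j <;>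
  simp [cliff_apply, Fintype.sum_prod_type, Fin.sum_univ_succ, quat] <;> ring

lemma cliff_I_smul (j : Fin 3) (x : TSpinor) :
    cliff j (Complex.I • x) = Complex.I • cliff j x := (cliffL j).map_smul _ _

/-- The operators i, I, J, K are isometries. Orthogonality holds because e_j, and e_j e_k for j ≠ k,
are skew. -/
lemma inner_momentField (a b : Fin 4) (w : TSpinor) :
    ⟪momentField a w, momentField b w⟫_ℝ = if a = b then ‖w‖ ^ 2 else 0 := by
  rw [real_inner_eq, normSq_eq]
  refine Fin.cases ?_ (fun i => ?_) a <;> refine Fin.cases ?_ (fun j => ?_) b <;>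
  simp only [momentField_zero, momentField_succ]
  · simp [Fintype.sum_prod_type, Fin.sum_univ_succ]; ring
  · fin_cases j <;>
    simp [Fintype.sum_prod_type, Fin.sum_univ_succ, cliff_apply, quat] <;> ring
  · fin_cases i <;>
    simp [Fintype.sum_prod_type, Fin.sum_univ_succ, cliff_apply, quat] <;> ring
  · fin_cases i <;> fin_cases j <;>
    simp [Fintype.sum_prod_type, Fin.sum_univ_succ, cliff_apply, quat] <;> ring

/-! ### The tangent space of the zero set of the moment map. -/

lemma dMoment_apply (w h : TSpinor) (i l : Fin 2) :
    dMoment w h i l = (∑ k, (w (i, k) * star (h (l, k)) + h (i, k) * star (w (l, k)))) -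
      (1 / 2 * ∑ m, ∑ k, (w (m, k) * star (h (m, k)) + h (m, k) * star (w (m, k)))) *
        (if i = l then 1 else 0) := by
  simp only [Finset.sum_add_distrib]
  simp only [← Finset.sum_add_distrib (s := (Finset.univ : Finset (Fin 2)))]
  rfl

/-- The matrix `dMoment w h` is hermitian and traceless, and the matrices i e_j form a basis of such
matrices. Its trace pairing with i e_j is twice the inner product on the right. -/
lemma dMoment_eq_zero_iff (w h : TSpinor) :
    dMoment w h = 0 ↔ ∀ j, ⟪h, Complex.I • cliff j w⟫_ℝ = 0 := by
  simp only [← Matrix.ext_iff, dMoment_apply, Fin.forall_fin_succ, real_inner_eq]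
  simp [Fintype.sum_prod_type, Fin.sum_univ_succ, cliff_apply, quat, Complex.ext_iff]
  constructor
  · rintro ⟨⟨h1, h2, h3⟩, ⟨h4, h5⟩, h6⟩
    refine ⟨?_, ?_, ?_⟩ <;> linarith
  · rintro ⟨h1, h2, h3⟩
    refine ⟨⟨?_, ?_, ?_⟩, ⟨?_, ?_⟩, ?_⟩ <;> first | linarith | constructor <;> linarith

lemma mem_tangentMmu_iff {w h : TSpinor} :
    h ∈ tangentMmu w ↔ ∀ j, ⟪h, Complex.I • cliff j w⟫_ℝ = 0 := dMoment_eq_zero_iff w h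

/-- Euler's identity for a quadratic map. -/
lemma dMoment_self (w : TSpinor) : dMoment w w = (2 : ℂ) • moment w := by
  have h : dMoment w w = (toMat w * (toMat w)ᴴ + toMat w * (toMat w)ᴴ) -
      ((1 / 2 : ℂ) * (toMat w * (toMat w)ᴴ + toMat w * (toMat w)ᴴ).trace) • 1 := rfl
  rw [h, moment, smul_sub, smul_smul, two_smul, Matrix.trace_add]
  congr 2
  ring

lemma self_mem_tangentMmu {w : TSpinor} (hw : w ∈ Mmu) : w ∈ tangentMmu w := by
  change dMoment w w = 0
  rw [dMoment_self, hw.1, smul_zero]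

/-! ### The embedding ι as minus the adjoint of c, and the space 𝓝. -/

lemma inner_iota (s : Fin 2 → ℂ) (h : TSpinor) :
    ⟪iota s, h⟫_ℝ = -∑ i, (s i * star (cliffMul h i)).re := by
  rw [real_inner_eq]
  simp [Fintype.sum_prod_type, Fin.sum_univ_succ, iota_apply, cliffMul_apply, quat]
  ring

lemma cliffMul_eq_zero_iff (h : TSpinor) : cliffMul h = 0 ↔ ∀ s, ⟪iota s, h⟫_ℝ = 0 := by
  constructor
  · intro hh s
    simp [inner_iota, hh]
  · intro hh
    have h0 := hh (cliffMul h)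
    rw [inner_iota, neg_eq_zero] at h0
    have h1 : ∀ i, (cliffMul h i * star (cliffMul h i)).re = Complex.normSq (cliffMul h i) :=
      fun i => by simp [Complex.mul_conj]
    simp only [h1] at h0
    rw [Finset.sum_eq_zero_iff_of_nonneg fun _ _ => Complex.normSq_nonneg _] at h0
    ext i
    exact Complex.normSq_eq_zero.1 (h0 i (Finset.mem_univ _))

/-- Since ∑ e_k ξ e_k = ξ for imaginary ξ, one has c(ξ·ι(s)) = ξs, and ξ acts on ℍ as |ξ| times an
isometry. -/
lemma normSq_cliffMul_cliff_iota (ξ : Fin 3 → ℝ) (s : Fin 2 → ℂ) :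
    ∑ i, Complex.normSq (cliffMul (∑ j, ξ j • cliff j (iota s)) i) =
      (∑ j, ξ j ^ 2) * ∑ i, Complex.normSq (s i) := by
  simp only [map_sum, map_smul, Finset.sum_apply, Pi.smul_apply]
  simp [Fin.sum_univ_succ, iota_apply, cliffMul_apply, cliff_apply, quat, Complex.normSq_apply]
  ring

lemma iotaCol_coord (k : Fin 3) (ψ : TSpinor) (p : Fin 2 × Fin 3) :
    iotaCol k ψ p = ∑ l, quat p.2 p.1 l * ψ (l, k) := rfl

lemma cliffMul_I_smul (ψ : TSpinor) : cliffMul (Complex.I • ψ) = Complex.I • cliffMul ψ := by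
  ext i
  simp only [cliffMul_apply, smul_I_apply, Pi.smul_apply, smul_eq_mul, Finset.mul_sum]
  exact Finset.sum_congr rfl fun j _ => Finset.sum_congr rfl fun l _ => by ring

/-- Anticommuting e_k past e_j gives c(e_j w) = -e_j c(w) - 2w_j, and c(ι(s)) = -3s turns -2w_j into
2/3 c(ι(w_j)). On ker c this lets e_j w be replaced by 2/3 ι(w_j) in products with ι(ℍ). -/
lemma cliffMul_cliff (j : Fin 3) (w : TSpinor) :
    cliffMul (cliff j w) =
      (2 / 3 : ℝ) • cliffMul (iotaCol j w) - quat j *ᵥ cliffMul w := by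
  ext i
  simp only [Pi.sub_apply, Pi.smul_apply, Matrix.mulVec, dotProduct]
  fin_cases j <;> fin_cases i <;>
  (simp [Fin.sum_univ_succ, iotaCol_coord, cliffMul_apply, cliff_apply, quat, Complex.ext_iff]
   constructor <;> ring)

lemma inner_iota_cliff {w : TSpinor} (hw : cliffMul w = 0) (s : Fin 2 → ℂ) (j : Fin 3) :
    ⟪iota s, cliff j w⟫_ℝ = 2 / 3 * ⟪iota s, iotaCol j w⟫_ℝ := by
  have h : cliffMul (cliff j w) = (2 / 3 : ℝ) • cliffMul (iotaCol j w) := by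
    rw [cliffMul_cliff, hw, Matrix.mulVec_zero, sub_zero]
  rw [inner_iota, inner_iota, h, mul_neg, Finset.mul_sum]
  refine congrArg _ (Finset.sum_congr rfl fun i _ => ?_)
  simp
  ring

lemma inner_iota_I_cliff {w : TSpinor} (hw : cliffMul w = 0) (s : Fin 2 → ℂ) (j : Fin 3) :
    ⟪iota s, Complex.I • cliff j w⟫_ℝ = 2 / 3 * ⟪iota s, Complex.I • iotaCol j w⟫_ℝ := by
  rw [← cliff_I_smul, ← map_smul]
  exact inner_iota_cliff (by rw [cliffMul_I_smul, hw, smul_zero]) s j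

/-- The factor 3 appears because each of the three unitary matrices e_j contributes the same
product. -/
lemma inner_iota_iotaCol (s : Fin 2 → ℂ) (k : Fin 3) (w : TSpinor) :
    ⟪iota s, iotaCol k w⟫_ℝ = 3 * (∑ i, s i * star (w (i, k))).re := by
  rw [real_inner_eq]
  simp [Fintype.sum_prod_type, Fin.sum_univ_succ, iota_apply, iotaCol_coord, quat]
  ring

lemma inner_iota_I_iotaCol (s : Fin 2 → ℂ) (k : Fin 3) (w : TSpinor) :
    ⟪iota s, Complex.I • iotaCol k w⟫_ℝ = 3 * (∑ i, s i * star (w (i, k))).im := by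
  rw [real_inner_eq]
  simp [Fintype.sum_prod_type, Fin.sum_univ_succ, iota_apply, iotaCol_coord, quat]
  ring

lemma iota_mem_tangentMmu_iff {w : TSpinor} (hw : cliffMul w = 0) (s : Fin 2 → ℂ) :
    iota s ∈ tangentMmu w ↔ ∀ k, (∑ i, s i * star (w (i, k))).im = 0 := by
  rw [mem_tangentMmu_iff]
  refine forall_congr' fun k => ?_
  rw [inner_iota_I_cliff hw, inner_iota_I_iotaCol]
  constructor <;> intro h <;> linarith

/-- The hermitian products of the columns of an element of `W^μ` are real. -/
lemma col_inner_im {w : TSpinor} (hw : w ∈ Wmu) (j k : Fin 3) :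
    (∑ i, w (i, j) * star (w (i, k))).im = 0 := by
  obtain ⟨hc, hm⟩ := hw
  have h0 := congrFun hc 0
  have h1 := congrFun hc 1
  have hm := mem_tangentMmu_iff.1 (self_mem_tangentMmu hm)
  have m0 := hm 0
  have m1 := hm 1
  have m2 := hm 2
  clear hm hc
  rw [cliffMul_apply] at h0 h1
  rw [real_inner_eq] at m0 m1 m2
  simp [Fin.sum_univ_succ, quat, Complex.ext_iff] at h0 h1
  simp [Fintype.sum_prod_type, Fin.sum_univ_succ, cliff_apply, quat] at m0 m1 m2
  obtain ⟨h2, h3⟩ := h0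
  obtain ⟨h4, h5⟩ := h1
  -- The equation c(w) = 0 is solved for the first column, w_0 = K w_1 - J w_2. After substitution
  -- the claim is linear in the moment map equations.
  have e1 : (w.ofLp (0, 0)).im = (w.ofLp (1, 1)).re - (w.ofLp (1, 2)).im := by linarith
  have e2 : (w.ofLp (0, 0)).re = -(w.ofLp (1, 1)).im - (w.ofLp (1, 2)).re := by linarith
  have e3 : (w.ofLp (1, 0)).im = (w.ofLp (0, 1)).re + (w.ofLp (0, 2)).im := by linarith
  have e4 : (w.ofLp (1, 0)).re = (w.ofLp (0, 2)).re - (w.ofLp (0, 1)).im := by linarith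
  clear h2 h3 h4 h5
  simp only [e1, e2, e3, e4] at m0 m1 m2
  fin_cases j <;> fin_cases k <;> simp [Fin.sum_univ_succ] <;> (try simp only [e1, e2, e3, e4]) <;>
    linarith

lemma mul_conjTranspose_of_moment {w : TSpinor} (hw : moment w = 0) (i l : Fin 2) :
    ∑ k, w (l, k) * star (w (i, k)) = if l = i then ((‖w‖ ^ 2 / 2 : ℝ) : ℂ) else 0 := by
  have h : toMat w * (toMat w)ᴴ = ((1 / 2 : ℂ) * (toMat w * (toMat w)ᴴ).trace) • 1 :=
    sub_eq_zero.1 hw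
  have ht : (toMat w * (toMat w)ᴴ).trace = ((‖w‖ ^ 2 : ℝ) : ℂ) := by
    rw [normSq_eq, Complex.ofReal_sum, Fintype.sum_prod_type]
    refine Finset.sum_congr rfl fun i _ => ?_
    refine (show _ = ∑ k, w (i, k) * star (w (i, k)) from rfl).trans ?_
    refine Finset.sum_congr rfl fun k _ => ?_
    change w (i, k) * star (w (i, k)) = _
    rw [RCLike.star_def, Complex.mul_conj, Complex.normSq_apply]
    push_cast
    ring
  have h1 := congrFun (congrFun h l) i
  rw [ht] at h1
  refine (show _ = _ from h1).trans ?_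
  rw [Matrix.smul_apply, Matrix.one_apply]
  split_ifs <;> simp
  ring

/-- For `w ∈ W^μ` the vectors `ι(w_k)` form a tight frame of `𝓝_w`. -/
lemma sum_inner_iotaCol {w : TSpinor} (hw : w ∈ Wmu) {s : Fin 2 → ℂ}
    (hs : iota s ∈ tangentMmu w) :
    ∑ k, ⟪iotaCol k w, iota s⟫_ℝ • iotaCol k w = (3 / 2 * ‖w‖ ^ 2) • iota s := by
  have hs := (iota_mem_tangentMmu_iff hw.1 s).1 hs
  simp only [iotaCol_apply, ← map_smul, ← map_sum]
  congr 1
  -- Tangency of ι(s) makes the hermitian products with the columns real, so the real inner product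
  -- loses nothing and the sum becomes 3ww*s = (3/2)|w|²s.
  have h1 : ∀ k, ((⟪iotaCol k w, iota s⟫_ℝ : ℝ) : ℂ) = 3 * ∑ i, s i * star (w (i, k)) := by
    intro k
    rw [real_inner_comm, inner_iota_iotaCol]
    refine Complex.ext ?_ ?_
    · rw [Complex.ofReal_re, Complex.mul_re]; simp
    · rw [Complex.ofReal_im, Complex.mul_im, hs k]; simp
  ext l
  simp only [Finset.sum_apply, Pi.smul_apply, ← iotaCol_apply, Complex.real_smul, h1]
  have h2 : ∑ k, 3 * (∑ i, s i * star (w (i, k))) * w (l, k) =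
      ∑ i, 3 * s i * ∑ k, w (l, k) * star (w (i, k)) := by
    simp only [Finset.mul_sum, Finset.sum_mul]
    rw [Finset.sum_comm]
    exact Finset.sum_congr rfl fun i _ => Finset.sum_congr rfl fun k _ => by ring
  refine h2.trans ?_
  simp only [mul_conjTranspose_of_moment hw.2.1, mul_ite, mul_zero, Finset.sum_ite_eq,
    Finset.mem_univ, if_true]
  push_cast
  ring

lemma iotaCol_mem_tangentMmu {w : TSpinor} (hw : w ∈ Wmu) (k : Fin 3) :
    iotaCol k w ∈ tangentMmu w :=
  (iota_mem_tangentMmu_iff hw.1 _).2 fun j => col_inner_im hw k j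

/-! ### The projections -/

lemma mem_lineL_orthogonal {w h : TSpinor} : h ∈ (lineL w)ᗮ ↔ ⟪h, Complex.I • w⟫_ℝ = 0 := by
  rw [lineL, Submodule.mem_orthogonal_singleton_iff_inner_left]

lemma mem_horizontal_iff {w h : TSpinor} :
    h ∈ horizontal w ↔ ∀ a, ⟪h, momentField a w⟫_ℝ = 0 := by
  rw [horizontal, Submodule.mem_inf, mem_lineL_orthogonal, mem_tangentMmu_iff,
    Fin.forall_fin_succ (P := fun a => ⟪h, momentField a w⟫_ℝ = 0)]
  exact and_comm

lemma iota_mem_horizontal {w : TSpinor} (hw : cliffMul w = 0) {s : Fin 2 → ℂ}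
    (hs : iota s ∈ tangentMmu w) : iota s ∈ horizontal w := by
  refine ⟨hs, mem_lineL_orthogonal.2 ((cliffMul_eq_zero_iff _).1 ?_ s)⟩
  rw [cliffMul_I_smul, hw, smul_zero]

lemma mem_calT_iff {w h : TSpinor} : h ∈ calT w ↔
    h ∈ horizontal w ∧ ∀ s, iota s ∈ tangentMmu w → ⟪h, iota s⟫_ℝ = 0 := by
  rw [calT, horizontal, Submodule.mem_inf, ← Submodule.inf_orthogonal, Submodule.mem_inf,
    Submodule.mem_inf, Submodule.mem_orthogonal', normalN]
  constructor
  · rintro ⟨h1, h2, h3⟩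
    exact ⟨⟨h1, h3⟩, fun s hs => h2 _ ⟨hs, s, rfl⟩⟩
  · rintro ⟨⟨h1, h3⟩, h2⟩
    refine ⟨h1, ?_, h3⟩
    rintro _ ⟨hs, s, rfl⟩
    exact h2 s hs

/-- The operator `h ↦ ⟪x, h⟫ x`. -/
def rankOne (x : TSpinor) : TSpinor →L[ℝ] TSpinor := (innerSL ℝ x).smulRight x

lemma rankOne_apply (x h : TSpinor) : rankOne x h = ⟪x, h⟫_ℝ • x := rfl

/-- A formula for the orthogonal projection onto `horizontal w` that makes sense for all `w ≠ 0`. -/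
def horProj (w : TSpinor) : TSpinor →L[ℝ] TSpinor :=
  ContinuousLinearMap.id ℝ TSpinor - (‖w‖ ^ 2)⁻¹ • ∑ a, rankOne (momentField a w)

/-- A formula for the orthogonal projection onto `calT w`, `w ∈ W^μ`. -/
def calTProj (w : TSpinor) : TSpinor →L[ℝ] TSpinor :=
  horProj w - (2 / 3 * (‖w‖ ^ 2)⁻¹) • ∑ k, rankOne (iotaCol k w)

lemma horProj_apply (w h : TSpinor) : horProj w h =
    h - (‖w‖ ^ 2)⁻¹ • ∑ a, ⟪momentField a w, h⟫_ℝ • momentField a w := by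
  simp [horProj, rankOne_apply]

lemma calTProj_apply (w h : TSpinor) : calTProj w h = horProj w h -
    (2 / 3 * (‖w‖ ^ 2)⁻¹) • ∑ k, ⟪iotaCol k w, h⟫_ℝ • iotaCol k w := by
  simp [calTProj, rankOne_apply]

lemma inner_rankOne (x h k : TSpinor) : ⟪rankOne x h, k⟫_ℝ = ⟪h, rankOne x k⟫_ℝ := by
  rw [rankOne_apply, rankOne_apply, real_inner_smul_left, real_inner_smul_right,
    real_inner_comm h x]
  ring

lemma inner_horProj (w h k : TSpinor) : ⟪horProj w h, k⟫_ℝ = ⟪h, horProj w k⟫_ℝ := by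
  simp [horProj, inner_sub_left, inner_sub_right, real_inner_smul_left, real_inner_smul_right,
    sum_inner, inner_sum, inner_rankOne]

lemma inner_calTProj (w h k : TSpinor) : ⟪calTProj w h, k⟫_ℝ = ⟪h, calTProj w k⟫_ℝ := by
  simp [calTProj, inner_sub_left, inner_sub_right, real_inner_smul_left, real_inner_smul_right,
    sum_inner, inner_sum, inner_rankOne, inner_horProj]

lemma horProj_of_mem {w h : TSpinor} (hh : h ∈ horizontal w) : horProj w h = h := by
  rw [mem_horizontal_iff] at hh
  simp [horProj_apply, real_inner_comm h, hh]

lemma horProj_momentField {w : TSpinor} (hw : w ≠ 0) (a : Fin 4) :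
    horProj w (momentField a w) = 0 := by
  have h : ‖w‖ ^ 2 ≠ 0 := pow_ne_zero 2 (norm_ne_zero_iff.2 hw)
  simp [horProj_apply, inner_momentField, smul_smul, h]

lemma horProj_mem {w : TSpinor} (hw : w ≠ 0) (h : TSpinor) : horProj w h ∈ horizontal w := by
  rw [mem_horizontal_iff]
  intro a
  rw [inner_horProj, horProj_momentField hw, inner_zero_right]

lemma projH_eq {w : TSpinor} (hw : w ≠ 0) : projH w = horProj w := by
  ext1 h
  refine Submodule.eq_starProjection_of_mem_of_inner_eq_zero (horProj_mem hw h) fun x hx => ?_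
  rw [inner_sub_left, inner_horProj, horProj_of_mem hx, sub_self]

/-- The coefficient 2/3 in `calTProj` is the inverse of the frame constant 3/2 in
`sum_inner_iotaCol`. -/
lemma calTProj_iota {w : TSpinor} (hw : w ∈ Wmu) {s : Fin 2 → ℂ}
    (hs : iota s ∈ tangentMmu w) : calTProj w (iota s) = 0 := by
  have h : ‖w‖ ^ 2 ≠ 0 := pow_ne_zero 2 (norm_ne_zero_iff.2 hw.2.2)
  rw [calTProj_apply, horProj_of_mem (iota_mem_horizontal hw.1 hs), sum_inner_iotaCol hw hs,
    smul_smul, sub_eq_zero]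
  conv_lhs => rw [← one_smul ℝ (iota s)]
  congr 1
  generalize ‖w‖ ^ 2 = n at h
  field_simp

lemma calTProj_momentField {w : TSpinor} (hw : w ∈ Wmu) (a : Fin 4) :
    calTProj w (momentField a w) = 0 := by
  have h : ∀ k, ⟪iotaCol k w, momentField a w⟫_ℝ = 0 := fun k =>
    mem_horizontal_iff.1 (iota_mem_horizontal hw.1 (iotaCol_mem_tangentMmu hw k)) a
  simp [calTProj_apply, horProj_momentField hw.2.2, h]

lemma calTProj_mem {w : TSpinor} (hw : w ∈ Wmu) (h : TSpinor) : calTProj w h ∈ calT w := by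
  rw [mem_calT_iff, mem_horizontal_iff]
  refine ⟨fun a => ?_, fun s hs => ?_⟩
  · rw [inner_calTProj, calTProj_momentField hw, inner_zero_right]
  · rw [inner_calTProj, calTProj_iota hw hs, inner_zero_right]

lemma calTProj_of_mem {w h : TSpinor} (hw : w ∈ Wmu) (hh : h ∈ calT w) : calTProj w h = h := by
  rw [mem_calT_iff] at hh
  have h1 : ∀ k, ⟪iotaCol k w, h⟫_ℝ = 0 := fun k => by
    rw [real_inner_comm]
    exact hh.2 _ (iotaCol_mem_tangentMmu hw k)
  simp [calTProj_apply, horProj_of_mem hh.1, h1]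

lemma projT_eq {w : TSpinor} (hw : w ∈ Wmu) : projT w = calTProj w := by
  ext1 h
  refine Submodule.eq_starProjection_of_mem_of_inner_eq_zero (calTProj_mem hw h) fun x hx => ?_
  rw [inner_sub_left, inner_calTProj, calTProj_of_mem hw hx, sub_self]

lemma calTProj_horProj {w : TSpinor} (hw : w ∈ Wmu) (h : TSpinor) :
    calTProj w (horProj w h) = calTProj w h := by
  rw [horProj_apply]
  simp [calTProj_momentField hw]

/-! ### The symbol -/

/-- The span of iw, iIw, iJw, iKw is invariant under the quaternions, which act by skew operators,
so its orthogonal complement is invariant too. -/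
lemma cliff_mem_horizontal {w h : TSpinor} (hh : h ∈ horizontal w) (j : Fin 3) :
    cliff j h ∈ horizontal w := by
  rw [mem_horizontal_iff] at hh ⊢
  have h0 := hh 0
  have h1 := hh (Fin.succ 0)
  have h2 := hh (Fin.succ 1)
  have h3 := hh (Fin.succ 2)
  clear hh
  simp only [momentField_zero, momentField_succ, real_inner_eq] at h0 h1 h2 h3
  refine Fin.cases ?_ fun k => ?_
  all_goals simp only [momentField_zero, momentField_succ, real_inner_eq]
  all_goals simp [Fintype.sum_prod_type, Fin.sum_univ_succ, cliff_apply, quat] at h0 h1 h2 h3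
  · fin_cases j <;> simp [Fintype.sum_prod_type, Fin.sum_univ_succ, cliff_apply, quat] <;> linarith
  · fin_cases j <;> fin_cases k <;>
    simp [Fintype.sum_prod_type, Fin.sum_univ_succ, cliff_apply, quat] <;> linarith

/-- The Clifford relation ξ·ξ = -|ξ|². -/
lemma sum_cliff_sum_cliff (ξ : Fin 3 → ℝ) (v : TSpinor) :
    ∑ j, ξ j • cliff j (∑ k, ξ k • cliff k v) = -(∑ j, ξ j ^ 2) • v := by
  simp only [sq]
  ext ⟨i, k⟩
  fin_cases i <;>
  (simp [Fin.sum_univ_succ, cliff_apply, quat, Complex.ext_iff]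
   constructor <;> ring)

lemma tangentW0_le_horizontal (w : TSpinor) : tangentW0 w ≤ horizontal w :=
  inf_le_inf_right _ inf_le_right

lemma tangentW0_le_calT (w : TSpinor) : tangentW0 w ≤ calT w := fun h hh =>
  mem_calT_iff.2 ⟨tangentW0_le_horizontal w hh, fun s _ => by
    rw [real_inner_comm]
    exact (cliffMul_eq_zero_iff h).1 hh.1.1 s⟩

lemma symbol_injective {w v : TSpinor} (hv : v ∈ tangentW0 w) {ξ : Fin 3 → ℝ}
    (hξ : ξ ≠ 0) (h : calTProj w (∑ j, ξ j • cliff j v) = 0) : v = 0 := by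
  have hξ : ∑ j, ξ j ^ 2 ≠ 0 := by
    intro h0
    rw [Finset.sum_eq_zero_iff_of_nonneg fun _ _ => sq_nonneg _] at h0
    exact hξ (funext fun j => by simpa using h0 j (Finset.mem_univ j))
  have hu : ∑ j, ξ j • cliff j v ∈ horizontal w := Submodule.sum_mem _ fun j _ =>
    Submodule.smul_mem _ _ (cliff_mem_horizontal (tangentW0_le_horizontal w hv) j)
  -- The vector is horizontal, so vanishing of its projection makes it a combination of the ι(w_k).
  obtain ⟨s, hs⟩ : ∃ s, ∑ j, ξ j • cliff j v = iota s := by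
    rw [calTProj_apply, horProj_of_mem hu, sub_eq_zero] at h
    simp only [iotaCol_apply, ← map_smul, ← map_sum] at h
    exact ⟨_, h⟩
  have h1 := sum_cliff_sum_cliff ξ v
  have h2 := normSq_cliffMul_cliff_iota ξ s
  rw [← hs, h1, map_smul, hv.1.1] at h2
  have h3 : ∑ i, Complex.normSq (s i) = 0 := by
    simpa [hξ] using h2.symm
  rw [Finset.sum_eq_zero_iff_of_nonneg fun _ _ => Complex.normSq_nonneg _] at h3
  have h4 : s = 0 := funext fun i => Complex.normSq_eq_zero.1 (h3 i (Finset.mem_univ _))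
  rw [hs, h4, map_zero] at h1
  have h6 : ∀ j, cliff j (0 : TSpinor) = 0 := fun j => map_zero (cliffL j)
  simp only [h6, smul_zero, Finset.sum_const_zero] at h1
  exact (smul_eq_zero.1 h1.symm).resolve_left (neg_ne_zero.2 hξ)

/-! ### The rank inequality. -/

lemma inner_I_smul_I_smul (x y : TSpinor) : ⟪Complex.I • x, Complex.I • y⟫_ℝ = ⟪x, y⟫_ℝ := by
  rw [inner_I_smul, smul_smul, Complex.I_mul_I, neg_one_smul, inner_neg_right, neg_neg]

lemma tangentW0_lt_calT {w : TSpinor} (hw : w ∈ Wmu) : tangentW0 w < calT w := by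
  refine lt_of_le_of_ne (tangentW0_le_calT w) fun heq => hw.2.2 ?_
  have hw0 : ‖w‖ ^ 2 ≠ 0 := pow_ne_zero 2 (norm_ne_zero_iff.2 hw.2.2)
  have hI : ∀ k, Complex.I • iotaCol k w = iota ((toMat (Complex.I • w)).col k) := fun k => by
    rw [← iotaCol_apply, map_smul]
  have key : ∀ k, iotaCol k w = 0 := by
    intro k
    -- The test vector is orthogonal to 𝓝_w because the hermitian products of s with the columns are
    -- real when ι(s) is tangent.
    have hT : horProj w (Complex.I • iotaCol k w) ∈ calT w := by
      refine mem_calT_iff.2 ⟨horProj_mem hw.2.2 _, fun s hs => ?_⟩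
      rw [inner_horProj, horProj_of_mem (iota_mem_horizontal hw.1 hs), real_inner_comm,
        inner_iota_I_iotaCol, (iota_mem_tangentMmu_iff hw.1 s).1 hs, mul_zero]
    rw [← heq] at hT
    -- Under the assumed equality the test vector lies in ker c, hence is orthogonal to ι(iw_k) =
    -- iι(w_k) itself.
    have h0 := (cliffMul_eq_zero_iff _).1 hT.1.1 ((toMat (Complex.I • w)).col k)
    rw [← hI, horProj_apply, Fin.sum_univ_succ, momentField_zero, inner_I_smul_I_smul] at h0
    have h1 : ⟪w, iotaCol k w⟫_ℝ = 0 := by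
      rw [real_inner_comm]
      exact (cliffMul_eq_zero_iff w).1 hw.1 _
    have h2 : ∀ j : Fin 3, ⟪momentField j.succ w, Complex.I • iotaCol k w⟫_ℝ =
        2 / 3 * ⟪iotaCol j w, iotaCol k w⟫_ℝ := fun j => by
      rw [momentField_succ, inner_I_smul_I_smul, real_inner_comm, iotaCol_apply k,
        inner_iota_cliff hw.1, real_inner_comm]
    have h3 := congrArg (fun x => ⟪iotaCol k w, x⟫_ℝ)
      (sum_inner_iotaCol hw (iotaCol_mem_tangentMmu hw k))
    simp only [h1, h2, zero_smul, zero_add, inner_sub_right, inner_sum, real_inner_smul_right,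
      inner_I_smul_I_smul, ← iotaCol_apply, real_inner_comm (momentField _ w)] at h0 h3
    have h4 : ∑ j : Fin 3, 2 / 3 * ⟪iotaCol j w, iotaCol k w⟫_ℝ *
        (2 / 3 * ⟪iotaCol j w, iotaCol k w⟫_ℝ) = 4 / 9 * ∑ j,
          ⟪iotaCol j w, iotaCol k w⟫_ℝ * ⟪iotaCol k w, iotaCol j w⟫_ℝ := by
      rw [Finset.mul_sum]
      refine Finset.sum_congr rfl fun j _ => ?_
      rw [real_inner_comm (iotaCol j w) (iotaCol k w)]
      ring
    rw [h4, h3] at h0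
    generalize ‖w‖ ^ 2 = n at h0 hw0
    field_simp at h0
    -- By the tight frame identity the product equals (1 - 4/9 · 3/2)|ι(w_k)|² = |ι(w_k)|²/3.
    exact (inner_self_eq_zero (𝕜 := ℝ)).1 (by linarith)
  ext ⟨i, k⟩
  -- The first column of ι(w_k) is I w_k, and I is diagonal and invertible.
  have h : iotaCol k w (i, 0) = 0 := by rw [key k]; rfl
  fin_cases i <;> simpa [Fin.sum_univ_succ, iotaCol_coord, quat] using h

/-! ### Smoothness and equivariance of the projections -/

lemma differentiableAt_rankOne {E : Type*} [NormedAddCommGroup E] [NormedSpace ℝ E]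
    {f : E → TSpinor} {x : E} (hf : DifferentiableAt ℝ f x) :
    DifferentiableAt ℝ (fun z => rankOne (f z)) x := by
  have h : ContDiff ℝ 1 rankOne := (innerSL ℝ : TSpinor →L[ℝ] _).contDiff.smulRight contDiff_id
  exact (h.differentiable one_ne_zero _).comp x hf

lemma differentiableAt_inv_normSq {w : TSpinor} (hw : w ≠ 0) :
    DifferentiableAt ℝ (fun z : TSpinor => (‖z‖ ^ 2)⁻¹) w :=
  (differentiableAt_id.norm_sq ℝ).inv (pow_ne_zero 2 (norm_ne_zero_iff.2 hw))

lemma differentiableAt_complexLinear (L : TSpinor →L[ℂ] TSpinor) (w : TSpinor) :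
    DifferentiableAt ℝ (fun z => L z) w :=
  (L.restrictScalars ℝ).differentiableAt

lemma differentiableAt_horProj {w : TSpinor} (hw : w ≠ 0) : DifferentiableAt ℝ horProj w := by
  refine (differentiableAt_const _).sub ((differentiableAt_inv_normSq hw).smul ?_)
  exact DifferentiableAt.fun_sum fun a _ =>
    differentiableAt_rankOne (differentiableAt_complexLinear _ _)

lemma differentiableAt_calTProj {w : TSpinor} (hw : w ≠ 0) : DifferentiableAt ℝ calTProj w := by
  refine (differentiableAt_horProj hw).sub
    (((differentiableAt_inv_normSq hw).const_mul (2 / 3)).smul ?_)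
  exact DifferentiableAt.fun_sum fun a _ =>
    differentiableAt_rankOne (differentiableAt_complexLinear _ _)

/-! ### Equivariance under U(1). -/

lemma inner_smul_smul_of_norm_one {c : ℂ} (hc : ‖c‖ = 1) (x y : TSpinor) :
    ⟪c • x, c • y⟫_ℝ = ⟪x, y⟫_ℝ := by
  have hc : c.re * c.re + c.im * c.im = 1 := by
    rw [← Complex.normSq_apply, ← Complex.sq_norm, hc, one_pow]
  rw [real_inner_eq, real_inner_eq]
  refine Finset.sum_congr rfl fun p _ => ?_
  simp only [PiLp.smul_apply, smul_eq_mul, Complex.mul_re, Complex.mul_im]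
  linear_combination ((x p).re * (y p).re + (x p).im * (y p).im) * hc

lemma rankOne_smul {c : ℂ} (hc : ‖c‖ = 1) (x h : TSpinor) :
    rankOne (c • x) (c • h) = c • rankOne x h := by
  rw [rankOne_apply, rankOne_apply, inner_smul_smul_of_norm_one hc, smul_comm]

/-- A family of operators on `S` is `U(1)`-equivariant. -/
def IsCircleEquivariant (P : TSpinor → TSpinor →L[ℝ] TSpinor) : Prop :=
  ∀ (c : ℂ), ‖c‖ = 1 → ∀ w h, P (c • w) (c • h) = c • P w h

lemma isCircleEquivariant_horProj : IsCircleEquivariant horProj := by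
  intro c hc w h
  simp [horProj, norm_smul, hc, rankOne_smul hc, smul_sub, Finset.smul_sum,
    smul_comm c ((‖w‖ ^ 2)⁻¹ : ℝ)]

lemma isCircleEquivariant_calTProj : IsCircleEquivariant calTProj := by
  intro c hc w h
  simp [calTProj, isCircleEquivariant_horProj c hc, norm_smul, hc, rankOne_smul hc, smul_sub,
    Finset.smul_sum, smul_comm c (2 / 3 * (‖w‖ ^ 2)⁻¹ : ℝ)]

/-- Differentiate the equivariance identity along c = exp(iθ) at θ = 0. This evaluates the
derivatives of the projections along the orbit. -/
lemma IsCircleEquivariant.fderiv_apply {P : TSpinor → TSpinor →L[ℝ] TSpinor}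
    (hP : IsCircleEquivariant P) {w : TSpinor} (hw : DifferentiableAt ℝ P w) (h : TSpinor) :
    fderiv ℝ P w (Complex.I • w) h = Complex.I • P w h - P w (Complex.I • h) := by
  have hc : ∀ x : TSpinor, HasDerivAt (fun θ : ℝ => Complex.exp (θ * Complex.I) • x)
      (Complex.I • x) 0 := by
    intro x
    have h1 : HasDerivAt (fun θ : ℝ => Complex.exp (θ * Complex.I)) Complex.I 0 := by
      have h2 : HasDerivAt (fun θ : ℝ => (θ : ℂ) * Complex.I) (1 * Complex.I) 0 :=
        (Complex.ofRealCLM.hasDerivAt (x := (0 : ℝ))).mul_const _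
      simpa using h2.cexp
    exact h1.smul_const x
  have h0 : Complex.exp (((0 : ℝ) : ℂ) * Complex.I) • w = w := by simp
  have h0' : Complex.exp (((0 : ℝ) : ℂ) * Complex.I) • h = h := by simp
  have h1 : HasDerivAt (fun θ : ℝ => P (Complex.exp (θ * Complex.I) • w))
      (fderiv ℝ P w (Complex.I • w)) 0 := by
    refine HasFDerivAt.comp_hasDerivAt 0 ?_ (hc w)
    rw [h0]
    exact hw.hasFDerivAt
  have h2 := h1.clm_apply (hc h)
  rw [h0, h0'] at h2
  have h3 : (fun θ : ℝ => P (Complex.exp (θ * Complex.I) • w) (Complex.exp (θ * Complex.I) • h)) =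
      fun θ : ℝ => Complex.exp (θ * Complex.I) • P w h :=
    funext fun θ => hP _ (Complex.norm_exp_ofReal_mul_I θ) w h
  rw [h3] at h2
  rw [eq_sub_iff_add_eq]
  exact h2.unique (hc _)

/-! ### Calculus in a chart -/

section Calculus

/-- Symmetry of the second derivative of F, applied to the directions (1, 0) and (0, X). It lets
∂/∂t pass through ∇. -/
lemma hasDerivAt_fderiv_swap {E G : Type*} [NormedAddCommGroup E] [NormedSpace ℝ E]
    [NormedAddCommGroup G] [NormedSpace ℝ G] {F : ℝ × E → G} {t : ℝ} {x : E}
    (hF : ContDiffAt ℝ ∞ F (t, x)) :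
    DifferentiableAt ℝ (fun z => deriv (fun s => F (s, z)) t) x ∧
      ∀ X, HasDerivAt (fun s => fderiv ℝ (fun z => F (s, z)) x X)
        (fderiv ℝ (fun z => deriv (fun s => F (s, z)) t) x X) t := by
  have hF : ContDiffAt ℝ 2 F (t, x) := hF.of_le ENat.LEInfty.out
  have h1 : ∀ᶠ q in nhds (t, x), DifferentiableAt ℝ F q := by
    have := hF.eventually (by simp)
    exact this.mono fun q hq => hq.differentiableAt (by simp)
  have h2 : DifferentiableAt ℝ (fderiv ℝ F) (t, x) :=
    (hF.fderiv_right (m := 1) (by norm_num)).differentiableAt (by simp)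
  have hz : ∀ᶠ z in nhds x, DifferentiableAt ℝ F (t, z) :=
    (Continuous.prodMk_right t).continuousAt.eventually h1
  have hs : ∀ᶠ s in nhds t, DifferentiableAt ℝ F (s, x) :=
    (Continuous.prodMk_left x).continuousAt.eventually h1
  have e1 : (fun z => deriv (fun s => F (s, z)) t) =ᶠ[nhds x] fun z => fderiv ℝ F (t, z) (1, 0) := by
    filter_upwards [hz] with z hz
    exact (hz.hasFDerivAt.comp_hasDerivAt t
      ((hasDerivAt_id t).prodMk (hasDerivAt_const t z))).deriv
  have e2 : ∀ X, (fun s => fderiv ℝ (fun z => F (s, z)) x X) =ᶠ[nhds t]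
      fun s => fderiv ℝ F (s, x) (0, X) := by
    intro X
    filter_upwards [hs] with s hs
    have := hs.hasFDerivAt.comp x ((hasFDerivAt_const s x).prodMk (hasFDerivAt_id x))
    have h3 := this.fderiv
    exact congrArg (fun L : E →L[ℝ] G => L X) h3
  have d1 : HasFDerivAt (fun z => fderiv ℝ F (t, z))
      ((fderiv ℝ (fderiv ℝ F) (t, x)).comp
        ((0 : E →L[ℝ] ℝ).prod (ContinuousLinearMap.id ℝ E))) x :=
    h2.hasFDerivAt.comp x ((hasFDerivAt_const t x).prodMk (hasFDerivAt_id x))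
  have d2 : HasDerivAt (fun s => fderiv ℝ F (s, x)) (fderiv ℝ (fderiv ℝ F) (t, x) (1, 0)) t :=
    h2.hasFDerivAt.comp_hasDerivAt t ((hasDerivAt_id t).prodMk (hasDerivAt_const t x))
  have d1' := d1.clm_apply (hasFDerivAt_const ((1 : ℝ), (0 : E)) x)
  refine ⟨(d1'.differentiableAt).congr_of_eventuallyEq e1, fun X => ?_⟩
  have d2' := d2.clm_apply (hasDerivAt_const t ((0 : ℝ), X))
  refine (d2'.congr_of_eventuallyEq (e2 X)).congr_deriv ?_
  rw [e1.fderiv_eq, d1'.fderiv]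
  have hsymm : IsSymmSndFDerivAt ℝ F (t, x) :=
    hF.isSymmSndFDerivAt minSmoothness_of_isRCLikeNormedField.le
  simpa using hsymm.eq (1, 0) (0, X)

variable {Y : Type*} [TopologicalSpace Y] [ChartedSpace E3 Y]
  {G : Type*} [NormedAddCommGroup G] [NormedSpace ℝ G]

/-- A map on `Y` in the preferred chart at `y`. -/
def inChart {Z : Type*} (y : Y) (f : Y → Z) : E3 → Z := fun x => f ((extChartAt 𝓘(ℝ, E3) y).symm x)

lemma inChart_self {Z : Type*} (y : Y) (f : Y → Z) : inChart y f (extChartAt 𝓘(ℝ, E3) y y) = f y := by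
  rw [inChart, extChartAt_to_inv]

lemma mdifferentiableAt_iff_inChart {f : Y → G} {y : Y} (hf : ContinuousAt f y) :
    MDifferentiableAt 𝓘(ℝ, E3) 𝓘(ℝ, G) f y ↔
      DifferentiableAt ℝ (inChart y f) (extChartAt 𝓘(ℝ, E3) y y) := by
  rw [mdifferentiableAt_iff]
  simp only [hf, true_and, modelWithCornersSelf_coe, Set.range_id, differentiableWithinAt_univ]
  rfl

lemma mfderiv_eq_inChart {f : Y → G} {y : Y} (hf : MDifferentiableAt 𝓘(ℝ, E3) 𝓘(ℝ, G) f y) :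
    (mfderiv 𝓘(ℝ, E3) 𝓘(ℝ, G) f y : E3 →L[ℝ] G) =
      fderiv ℝ (inChart y f) (extChartAt 𝓘(ℝ, E3) y y) := by
  rw [hf.mfderiv]
  simp only [modelWithCornersSelf_coe, Set.range_id, fderivWithin_univ]
  rfl

lemma contDiffAt_inChart [IsManifold 𝓘(ℝ, E3) ∞ Y] {W : ℝ → Y → G} {y : Y} {t : ℝ}
    (hW : ContMDiffAt (𝓘(ℝ, ℝ).prod 𝓘(ℝ, E3)) 𝓘(ℝ, G) ∞ (fun q : ℝ × Y => W q.1 q.2) (t, y)) :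
    ContDiffAt ℝ ∞ (fun q : ℝ × E3 => inChart y (W q.1) q.2) (t, extChartAt 𝓘(ℝ, E3) y y) := by
  have h := (contMDiffAt_iff.1 hW).2
  simp only [extChartAt_prod] at h
  have hr : Set.range (𝓘(ℝ, ℝ).prod 𝓘(ℝ, E3)) = Set.univ := by
    rw [ModelWithCorners.range_eq_univ]
  rw [hr, contDiffWithinAt_univ] at h
  exact h

end Calculus

/-! ### The linearization at a point -/

/-- The infinitesimal action of an element of `𝔲(2)`, as a continuous complex linear map. -/
def infActL (X : Matrix (Fin 2) (Fin 2) ℂ) : TSpinor →L[ℂ] TSpinor :=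
  LinearMap.toContinuousLinearMap
    { toFun := infAct X
      map_add' := fun ψ χ => by
        simp only [infAct, map_add, Matrix.mul_add, Matrix.add_mul]
        abel
      map_smul' := fun r ψ => by simp [infAct] }

lemma cliff_add (j : Fin 3) (x y : TSpinor) : cliff j (x + y) = cliff j x + cliff j y :=
  map_add (cliffL j) x y

lemma cliff_smul (j : Fin 3) (r : ℝ) (x : TSpinor) : cliff j (r • x) = r • cliff j x :=
  map_smul ((cliffL j).restrictScalars ℝ) r x

lemma smul_I_comm (r : ℝ) (x : TSpinor) : Complex.I • r • x = r • Complex.I • x :=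
  smul_comm _ _ _

/-- The Clifford contraction `∑ⱼ eⱼ Xⱼ` of the horizontal parts of the `Xⱼ`. -/
def horDirac (w : TSpinor) (X : Fin 3 → TSpinor) : TSpinor := ∑ j, cliff j (horProj w (X j))

/-- The term of order zero by which the linearization of the `3/2`-Fueter operator differs from
the projected Dirac operator; `X j` is the covariant derivative of the lift `w` along `eⱼ`. -/
def zeroOrder (w : TSpinor) (X : Fin 3 → TSpinor) : TSpinor →ₗ[ℝ] TSpinor where
  toFun u := calTProj w (fderiv ℝ calTProj w u (horDirac w X) +
    ∑ j, cliff j (fderiv ℝ horProj w u (X j) +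
      (⟪Complex.I • w, X j⟫_ℝ / ‖w‖ ^ 2) • horProj w (Complex.I • u)))
  map_add' u u' := by
    rw [← map_add]
    congr 1
    simp only [map_add, smul_add, add_apply, cliff_add,
      Finset.sum_add_distrib]
    abel
  map_smul' r u := by
    rw [RingHom.id_apply, ← map_smul]
    congr 1
    simp only [map_smul, smul_I_comm, smul_apply, smul_add, Finset.smul_sum,
      cliff_add, cliff_smul, smul_comm r (_ / _ : ℝ)]

lemma calTProj_idem {w : TSpinor} (hw : w ∈ Wmu) (h : TSpinor) :
    calTProj w (calTProj w h) = calTProj w h := calTProj_of_mem hw (calTProj_mem hw h)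

lemma smul_I_horDirac (w : TSpinor) (X : Fin 3 → TSpinor) :
    Complex.I • horDirac w X = ∑ j, cliff j (Complex.I • horProj w (X j)) := by
  simp only [horDirac, Finset.smul_sum, cliff_I_smul]

/-- The algebraic core: `X`, `D` and `X'` stand for the covariant derivatives of w, of v and of the
velocity v + λiw, with `l` = λ and `d` its derivative. The term subtracted on the left is the
Levi-Civita correction for the motion along the orbit. -/
lemma linearization_pointwise {w : TSpinor} (hw : w ∈ Wmu) (X X' D : Fin 3 → TSpinor)
    (d : Fin 3 → ℝ) (l : ℝ) (v : TSpinor)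
    (hX' : ∀ j, X' j = D j + d j • Complex.I • w + l • Complex.I • X j) :
    calTProj w (fderiv ℝ calTProj w (v + l • Complex.I • w) (horDirac w X) +
        calTProj w (∑ j, cliff j (fderiv ℝ horProj w (v + l • Complex.I • w) (X j) +
          horProj w (X' j))) -
        l • Complex.I • calTProj w (horDirac w X)) =
      calTProj w (∑ j, cliff j (horProj w (D j - (⟪Complex.I • w, X j⟫_ℝ / ‖w‖ ^ 2) •
        (Complex.I • v)))) + zeroOrder w X v := by
  have e1 := isCircleEquivariant_calTProj.fderiv_apply (differentiableAt_calTProj hw.2.2)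
  have e2 := isCircleEquivariant_horProj.fderiv_apply (differentiableAt_horProj hw.2.2)
  have e3 : horProj w (Complex.I • w) = 0 := horProj_momentField hw.2.2 0
  -- By equivariance of `horProj` the λ-terms add up to λi times the Fueter term, and `e3` removes
  -- `d`.
  have hZ : ∑ j, cliff j (fderiv ℝ horProj w (v + l • Complex.I • w) (X j) + horProj w (X' j)) =
      ∑ j, cliff j (fderiv ℝ horProj w v (X j) + horProj w (D j)) +
        l • Complex.I • horDirac w X := by
    rw [smul_I_horDirac, Finset.smul_sum, ← Finset.sum_add_distrib]
    refine Finset.sum_congr rfl fun j _ => ?_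
    rw [← cliff_smul, ← cliff_add]
    congr 1
    simp only [hX', map_add, map_smul, add_apply,
      smul_apply, e2, e3, smul_sub, smul_zero]
    abel
  rw [hZ]
  have hB : zeroOrder w X v = calTProj w (fderiv ℝ calTProj w v (horDirac w X) +
    ∑ j, cliff j (fderiv ℝ horProj w v (X j) +
      (⟪Complex.I • w, X j⟫_ℝ / ‖w‖ ^ 2) • horProj w (Complex.I • v))) := rfl
  have hS : ∑ j, cliff j (horProj w (D j - (⟪Complex.I • w, X j⟫_ℝ / ‖w‖ ^ 2) •
        (Complex.I • v))) + ∑ j, cliff j (fderiv ℝ horProj w v (X j) +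
      (⟪Complex.I • w, X j⟫_ℝ / ‖w‖ ^ 2) • horProj w (Complex.I • v)) =
      ∑ j, cliff j (fderiv ℝ horProj w v (X j) + horProj w (D j)) := by
    rw [← Finset.sum_add_distrib]
    refine Finset.sum_congr rfl fun j _ => ?_
    rw [← cliff_add]
    congr 1
    simp only [map_sub, map_smul]
    abel
  -- The remaining λ-terms cancel by equivariance and idempotence of `calTProj`.
  rw [hB, ← map_add, add_left_comm, hS]
  simp only [map_add, map_sub, map_smul, add_apply,
      smul_apply, e1, smul_sub, calTProj_idem hw]
  abel

/-! ### Covariant derivatives -/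

section Manifold

variable {Y : Type*} [TopologicalSpace Y] [ChartedSpace E3 Y]
  {G : Type*} [NormedAddCommGroup G] [NormedSpace ℝ G]

/-- The directional derivative of a map to a normed space, with values in that space. -/
def dirDeriv (f : Y → G) (y : Y) (X : TangentSpace 𝓘(ℝ, E3) y) : G :=
  mfderiv 𝓘(ℝ, E3) 𝓘(ℝ, G) f y X

lemma dirDeriv_congr {f f₁ : Y → G} {y : Y} (h : f₁ =ᶠ[nhds y] f) (X) :
    dirDeriv f₁ y X = dirDeriv f y X :=
  congrArg (fun L : E3 →L[ℝ] G => L X) h.mfderiv_eq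

lemma hasFDerivAt_inChart {f : Y → G} {y : Y} (hf : MDifferentiableAt 𝓘(ℝ, E3) 𝓘(ℝ, G) f y) :
    HasFDerivAt (inChart y f) (mfderiv 𝓘(ℝ, E3) 𝓘(ℝ, G) f y : E3 →L[ℝ] G)
      (extChartAt 𝓘(ℝ, E3) y y) := by
  rw [mfderiv_eq_inChart hf]
  exact ((mdifferentiableAt_iff_inChart hf.continuousAt).1 hf).hasFDerivAt

lemma mdifferentiableAt_of_hasFDerivAt_inChart {f : Y → G} {y : Y} {f' : E3 →L[ℝ] G}
    (hf : ContinuousAt f y) (h : HasFDerivAt (inChart y f) f' (extChartAt 𝓘(ℝ, E3) y y)) :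
    MDifferentiableAt 𝓘(ℝ, E3) 𝓘(ℝ, G) f y ∧ ∀ X, dirDeriv f y X = f' X := by
  have hm := (mdifferentiableAt_iff_inChart hf).2 h.differentiableAt
  exact ⟨hm, fun X =>
    congrArg (fun L : E3 →L[ℝ] G => L X) ((mfderiv_eq_inChart hm).trans h.fderiv)⟩

lemma dirDeriv_fun_smul {f : Y → ℝ} {v : Y → G} {y : Y}
    (hf : MDifferentiableAt 𝓘(ℝ, E3) 𝓘(ℝ, ℝ) f y) (hv : MDifferentiableAt 𝓘(ℝ, E3) 𝓘(ℝ, G) v y) :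
    MDifferentiableAt 𝓘(ℝ, E3) 𝓘(ℝ, G) (fun z => f z • v z) y ∧ ∀ X,
      dirDeriv (fun z => f z • v z) y X = f y • dirDeriv v y X + dirDeriv f y X • v y := by
  have h := mdifferentiableAt_of_hasFDerivAt_inChart (f := fun z => f z • v z)
    (hf.continuousAt.smul hv.continuousAt) ((hasFDerivAt_inChart hf).smul (hasFDerivAt_inChart hv))
  refine ⟨h.1, fun X => (h.2 X).trans ?_⟩
  rw [inChart, extChartAt_to_inv]
  rfl

lemma dirDeriv_fun_add {f v : Y → G} {y : Y}
    (hf : MDifferentiableAt 𝓘(ℝ, E3) 𝓘(ℝ, G) f y) (hv : MDifferentiableAt 𝓘(ℝ, E3) 𝓘(ℝ, G) v y) :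
    MDifferentiableAt 𝓘(ℝ, E3) 𝓘(ℝ, G) (fun z => f z + v z) y ∧ ∀ X,
      dirDeriv (fun z => f z + v z) y X = dirDeriv f y X + dirDeriv v y X :=
  mdifferentiableAt_of_hasFDerivAt_inChart (f := fun z => f z + v z)
    (hf.continuousAt.add hv.continuousAt) ((hasFDerivAt_inChart hf).add (hasFDerivAt_inChart hv))

lemma dirDeriv_I_smul {v : Y → TSpinor} {y : Y}
    (hv : MDifferentiableAt 𝓘(ℝ, E3) 𝓘(ℝ, TSpinor) v y) :
    MDifferentiableAt 𝓘(ℝ, E3) 𝓘(ℝ, TSpinor) (fun z => Complex.I • v z) y ∧ ∀ X,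
      dirDeriv (fun z => Complex.I • v z) y X = Complex.I • dirDeriv v y X :=
  mdifferentiableAt_of_hasFDerivAt_inChart (f := fun z => Complex.I • v z)
    (hv.continuousAt.const_smul Complex.I) ((hasFDerivAt_inChart hv).const_smul Complex.I)

variable [IsManifold 𝓘(ℝ, E3) ∞ Y] {g : Bundle.ContMDiffRiemannianMetric 𝓘(ℝ, E3) ∞ E3
  (TangentSpace 𝓘(ℝ, E3) : Y → Type _)} {ι : Type*} {P : SpinCStructure g ι}
  (A : PrincipalConnection P) (a : ι)

lemma nabla_eq (w : Y → TSpinor) (y : Y) (X : TangentSpace 𝓘(ℝ, E3) y) :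
    nabla A a w y X = dirDeriv w y X +
      infActL (A.form a y X) (w y) := rfl

lemma nabla_congr {w w₁ : Y → TSpinor} {y : Y} (h : w₁ =ᶠ[nhds y] w) :
    nabla A a w₁ y = nabla A a w y := by
  funext X
  rw [nabla_eq, nabla_eq, dirDeriv_congr h, h.eq_of_nhds]

lemma nabla_smul {f : Y → ℝ} {v : Y → TSpinor} {y : Y}
    (hf : MDifferentiableAt 𝓘(ℝ, E3) 𝓘(ℝ, ℝ) f y)
    (hv : MDifferentiableAt 𝓘(ℝ, E3) 𝓘(ℝ, TSpinor) v y) (X : TangentSpace 𝓘(ℝ, E3) y) :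
    nabla A a (fun z => f z • v z) y X = f y • nabla A a v y X +
      dirDeriv f y X • v y := by
  have h : infActL (A.form a y X) (f y • v y) = f y • infActL (A.form a y X) (v y) :=
    map_smul ((infActL (A.form a y X)).restrictScalars ℝ) _ _
  rw [nabla_eq, nabla_eq, (dirDeriv_fun_smul hf hv).2, h, smul_add]
  abel

lemma nabla_add {u v : Y → TSpinor} {y : Y}
    (hu : MDifferentiableAt 𝓘(ℝ, E3) 𝓘(ℝ, TSpinor) u y)
    (hv : MDifferentiableAt 𝓘(ℝ, E3) 𝓘(ℝ, TSpinor) v y) (X : TangentSpace 𝓘(ℝ, E3) y) :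
    nabla A a (fun z => u z + v z) y X = nabla A a u y X + nabla A a v y X := by
  rw [nabla_eq, nabla_eq, nabla_eq, (dirDeriv_fun_add hu hv).2, map_add]
  abel

lemma nabla_I_smul {v : Y → TSpinor} {y : Y}
    (hv : MDifferentiableAt 𝓘(ℝ, E3) 𝓘(ℝ, TSpinor) v y) (X : TangentSpace 𝓘(ℝ, E3) y) :
    nabla A a (fun z => Complex.I • v z) y X = Complex.I • nabla A a v y X := by
  rw [nabla_eq, nabla_eq, (dirDeriv_I_smul hv).2, map_smul, smul_add]

/-! ### The operators in terms of the explicit projections. -/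

lemma fueter_eq {w : Y → TSpinor} {y : Y} (hw : w y ≠ 0) :
    fueter A a w y = horDirac (w y) fun j => nabla A a w y (P.frame a j y) := by
  rw [fueter, projH_eq hw, horDirac]

lemma threeHalfFueter_eq {w : Y → TSpinor} {y : Y} (hw : w y ∈ Wmu) :
    threeHalfFueter A a w y =
      calTProj (w y) (horDirac (w y) fun j => nabla A a w y (P.frame a j y)) := by
  rw [threeHalfFueter, projT_eq hw, fueter_eq A a hw.2.2]

lemma linearizedFueter_eq {w v : Y → TSpinor} {y : Y} (hw : w y ∈ Wmu) :
    linearizedFueter A a w v y = calTProj (w y) (∑ j, cliff j (horProj (w y)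
      (nabla A a v y (P.frame a j y) -
        (⟪Complex.I • w y, nabla A a w y (P.frame a j y)⟫_ℝ / ‖w y‖ ^ 2) •
          (Complex.I • v y)))) := by
  simp only [linearizedFueter, dirac, leviCivita, projT_eq hw, projH_eq hw.2.2]

/-- Three orthonormal vectors form a basis of the tangent space, so a covector is determined by its
values on them. -/
lemma frame_ne_zero {y : Y} (hy : y ∈ P.U a) {ξ : TangentSpace 𝓘(ℝ, E3) y →L[ℝ] ℝ}
    (hξ : ξ ≠ 0) : (fun j => ξ (P.frame a j y)) ≠ 0 := by
  intro h
  have hli : LinearIndependent ℝ fun j => P.frame a j y := by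
    rw [Fintype.linearIndependent_iff]
    intro c hc i
    have h1 := congrArg (g.inner y (P.frame a i y)) hc
    rw [map_sum, map_zero] at h1
    simpa [P.frame_orthonormal a y hy] using h1
  have hcard : Fintype.card (Fin 3) = Module.finrank ℝ (TangentSpace 𝓘(ℝ, E3) y) := by
    change _ = Module.finrank ℝ E3
    simp
  have : FiniteDimensional ℝ (TangentSpace 𝓘(ℝ, E3) y) := inferInstanceAs (FiniteDimensional ℝ E3)
  have hspan := hli.span_eq_top_of_card_eq_finrank' hcard
  refine hξ (ContinuousLinearMap.coe_injective (LinearMap.ext_on_range hspan fun j => ?_))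
  exact congrFun h j

end Manifold

/-! ### Variations -/

lemma hasDerivAt_calTProj_horDirac {c : ℝ → TSpinor} {c' : TSpinor} {X : Fin 3 → ℝ → TSpinor}
    {X' : Fin 3 → TSpinor} {t : ℝ} (hc : HasDerivAt c c' t) (hX : ∀ j, HasDerivAt (X j) (X' j) t)
    (h0 : c t ≠ 0) :
    HasDerivAt (fun s => calTProj (c s) (horDirac (c s) fun j => X j s))
      (fderiv ℝ calTProj (c t) c' (horDirac (c t) fun j => X j t) +
        calTProj (c t) (∑ j, cliff j (fderiv ℝ horProj (c t) c' (X j t) +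
          horProj (c t) (X' j)))) t := by
  have hT : HasDerivAt (fun s => calTProj (c s)) (fderiv ℝ calTProj (c t) c') t :=
    (differentiableAt_calTProj h0).hasFDerivAt.comp_hasDerivAt t hc
  have hH : HasDerivAt (fun s => horProj (c s)) (fderiv ℝ horProj (c t) c') t :=
    (differentiableAt_horProj h0).hasFDerivAt.comp_hasDerivAt t hc
  have hj : ∀ j, HasDerivAt (fun s => cliff j (horProj (c s) (X j s)))
      (cliff j (fderiv ℝ horProj (c t) c' (X j t) + horProj (c t) (X' j))) t := fun j =>
    ((cliffL j).restrictScalars ℝ).hasFDerivAt.comp_hasDerivAt t (hH.clm_apply (hX j))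
  have hZ : HasDerivAt (fun s => horDirac (c s) fun j => X j s)
      (∑ j, cliff j (fderiv ℝ horProj (c t) c' (X j t) + horProj (c t) (X' j))) t :=
    HasDerivAt.fun_sum fun j _ => hj j
  exact hT.clm_apply hZ

section Manifold

variable {Y : Type*} [TopologicalSpace Y] [ChartedSpace E3 Y]
  {G : Type*} [NormedAddCommGroup G] [NormedSpace ℝ G]

lemma mdifferentiableAt_of_inChart {f : Y → G} {y : Y}
    (h : DifferentiableAt ℝ (inChart y f) (extChartAt 𝓘(ℝ, E3) y y)) :
    MDifferentiableAt 𝓘(ℝ, E3) 𝓘(ℝ, G) f y := by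
  refine (mdifferentiableAt_iff_inChart ?_).2 h
  have h1 : ContinuousAt (fun z => inChart y f (extChartAt 𝓘(ℝ, E3) y z)) y :=
    ContinuousAt.comp (g := inChart y f) h.continuousAt (continuousAt_extChartAt y)
  refine h1.congr ?_
  filter_upwards [extChartAt_source_mem_nhds (I := 𝓘(ℝ, E3)) y] with z hz
  rw [inChart, (extChartAt 𝓘(ℝ, E3) y).left_inv hz]

variable {V : Set Y} {w v : Y → TSpinor} {W : ℝ → Y → TSpinor}

/-- The velocity of a family of lifts. -/
def lineVelocity (W : ℝ → Y → TSpinor) (y : Y) : TSpinor := deriv (fun t => W t y) 0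

/-- The coefficient of the component of the velocity along the orbit. -/
def orbitSpeed (w : Y → TSpinor) (W : ℝ → Y → TSpinor) (y : Y) : ℝ :=
  ⟪Complex.I • w y, lineVelocity W y⟫_ℝ / ‖w y‖ ^ 2

lemma mdifferentiableAt_orbitSpeed {y : Y} (hw : MDifferentiableAt 𝓘(ℝ, E3) 𝓘(ℝ, TSpinor) w y)
    (hw0 : w y ≠ 0) (hW : MDifferentiableAt 𝓘(ℝ, E3) 𝓘(ℝ, TSpinor) (lineVelocity W) y) :
    MDifferentiableAt 𝓘(ℝ, E3) 𝓘(ℝ, ℝ) (orbitSpeed w W) y := by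
  refine mdifferentiableAt_of_inChart ?_
  have h1 := (hasFDerivAt_inChart hw).differentiableAt
  have h2 := (hasFDerivAt_inChart hW).differentiableAt
  have h3 : ‖inChart y w (extChartAt 𝓘(ℝ, E3) y y)‖ ^ 2 ≠ 0 := by
    rw [inChart_self]
    exact pow_ne_zero 2 (norm_ne_zero_iff.2 hw0)
  have h4 := ((h1.const_smul Complex.I).inner ℝ h2).mul ((h1.norm_sq ℝ).inv h3)
  refine h4.congr_of_eventuallyEq (Filter.Eventually.of_forall fun x => ?_)
  exact div_eq_mul_inv _ _

lemma IsVariation.eventually_contMDiffAt (h : IsVariation V w v W) (hV : IsOpen V) {y : Y}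
    (hy : y ∈ V) : ∀ᶠ t in nhds (0 : ℝ), ContMDiffAt (𝓘(ℝ, ℝ).prod 𝓘(ℝ, E3)) 𝓘(ℝ, TSpinor) ∞
      (fun q : ℝ × Y => W q.1 q.2) (t, y) := by
  obtain ⟨ε, hε, hs, -⟩ := h.smooth
  filter_upwards [Ioo_mem_nhds (neg_lt_zero.2 hε) hε] with t ht
  exact hs.contMDiffAt ((isOpen_Ioo.prod hV).mem_nhds ⟨ht, hy⟩)

lemma IsVariation.eventually_mem (h : IsVariation V w v W) {y : Y} (hy : y ∈ V) :
    ∀ᶠ t in nhds (0 : ℝ), W t y ∈ Wmu := by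
  obtain ⟨ε, hε, -, hs⟩ := h.smooth
  filter_upwards [Ioo_mem_nhds (neg_lt_zero.2 hε) hε] with t ht
  exact hs t ht y hy

variable [IsManifold 𝓘(ℝ, E3) ∞ Y]

lemma IsVariation.hasDerivAt (h : IsVariation V w v W) (hV : IsOpen V) {y : Y} (hy : y ∈ V) :
    HasDerivAt (fun t => W t y) (lineVelocity W y) 0 := by
  have h1 := contDiffAt_inChart (h.eventually_contMDiffAt hV hy).self_of_nhds
  have h2 : DifferentiableAt ℝ (fun t : ℝ => inChart y (W t) (extChartAt 𝓘(ℝ, E3) y y)) 0 :=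
    DifferentiableAt.comp (f := fun t : ℝ => (t, extChartAt 𝓘(ℝ, E3) y y)) (0 : ℝ)
      (h1.differentiableAt (by simp))
      (differentiableAt_id.prodMk (differentiableAt_const _))
  simp only [inChart_self] at h2
  exact h2.hasDerivAt

lemma IsVariation.mdifferentiableAt (h : IsVariation V w v W) (hV : IsOpen V) {y : Y}
    (hy : y ∈ V) : MDifferentiableAt 𝓘(ℝ, E3) 𝓘(ℝ, TSpinor) (lineVelocity W) y ∧
      ∀ X, HasDerivAt (fun t => dirDeriv (W t) y X) (dirDeriv (lineVelocity W) y X) 0 := by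
  have h0 := h.eventually_contMDiffAt hV hy
  obtain ⟨h1, h2⟩ := hasDerivAt_fderiv_swap (contDiffAt_inChart h0.self_of_nhds)
  have h3 : MDifferentiableAt 𝓘(ℝ, E3) 𝓘(ℝ, TSpinor) (lineVelocity W) y :=
    mdifferentiableAt_of_inChart h1
  refine ⟨h3, fun X => ?_⟩
  have h4 : dirDeriv (lineVelocity W) y X = _ :=
    congrArg (fun L : E3 →L[ℝ] TSpinor => L X) (mfderiv_eq_inChart h3)
  rw [h4]
  refine (h2 X).congr_of_eventuallyEq ?_
  filter_upwards [h0] with t ht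
  have h5 : DifferentiableAt ℝ (inChart y (W t)) (extChartAt 𝓘(ℝ, E3) y y) :=
    DifferentiableAt.comp (f := fun x : E3 => (t, x)) (extChartAt 𝓘(ℝ, E3) y y)
      ((contDiffAt_inChart ht).differentiableAt (by simp))
      ((differentiableAt_const _).prodMk differentiableAt_id)
  exact congrArg (fun L : E3 →L[ℝ] TSpinor => L X)
    (mfderiv_eq_inChart (mdifferentiableAt_of_inChart h5))

/-- Differentiate ⟪W_t, i e_j W_t⟫ = 0 at t = 0. The operator i e_j is symmetric, so the two terms
of the product rule agree. -/
lemma IsVariation.lineVelocity_mem_tangentMmu (h : IsVariation V w v W) (hV : IsOpen V) {y : Y}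
    (hy : y ∈ V) : lineVelocity W y ∈ tangentMmu (w y) := by
  rw [mem_tangentMmu_iff]
  intro j
  have h1 := h.hasDerivAt hV hy
  have h2 : HasDerivAt (fun t => Complex.I • cliff j (W t y))
      (Complex.I • cliff j (lineVelocity W y)) 0 :=
    (((Complex.I • cliffL j).restrictScalars ℝ).hasFDerivAt).comp_hasDerivAt 0 h1
  have h3 := (h1.inner ℝ h2).unique
    (((hasDerivAt_const (0 : ℝ) (0 : ℝ))).congr_of_eventuallyEq (by
      filter_upwards [h.eventually_mem hy] with t ht
      exact mem_tangentMmu_iff.1 (self_mem_tangentMmu ht.2) j))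
  rw [h.zero y hy, ← cliff_I_smul, ← neg_eq_iff_eq_neg.2 (inner_cliff j _ _), ← neg_neg
    (⟪cliff j (w y), _⟫_ℝ), ← inner_I_smul, real_inner_comm] at h3
  linarith

/-- For a vector tangent to M^μ the horizontal projection removes only the component along iw. -/
lemma IsVariation.lineVelocity_eq (h : IsVariation V w v W) (hV : IsOpen V) {y : Y}
    (hy : y ∈ V) (hw : w y ≠ 0) :
    lineVelocity W y = v y + orbitSpeed w W y • Complex.I • w y := by
  have h1 := h.velocity y hy
  have h2 := mem_tangentMmu_iff.1 (h.lineVelocity_mem_tangentMmu hV hy)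
  have h3 : ∀ j : Fin 3, ⟪momentField j.succ (w y), lineVelocity W y⟫_ℝ = 0 := fun j => by
    rw [real_inner_comm]
    exact h2 j
  rw [← h1, projH_eq hw, horProj_apply, Fin.sum_univ_succ]
  change _ = lineVelocity W y - (‖w y‖ ^ 2)⁻¹ • (⟪momentField 0 (w y), lineVelocity W y⟫_ℝ •
    momentField 0 (w y) + ∑ j : Fin 3, ⟪momentField j.succ (w y), lineVelocity W y⟫_ℝ •
    momentField j.succ (w y)) + _
  simp only [h3, zero_smul, Finset.sum_const_zero, add_zero, momentField_zero, smul_smul]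
  rw [orbitSpeed, div_eq_inv_mul, sub_add_cancel]

variable {g : Bundle.ContMDiffRiemannianMetric 𝓘(ℝ, E3) ∞ E3
  (TangentSpace 𝓘(ℝ, E3) : Y → Type _)} {ι : Type*} {P : SpinCStructure g ι}
  (A : PrincipalConnection P) (a : ι)

lemma IsVariation.hasDerivAt_nabla (h : IsVariation V w v W) (hV : IsOpen V) {y : Y}
    (hy : y ∈ V) (X : TangentSpace 𝓘(ℝ, E3) y) :
    HasDerivAt (fun t => nabla A a (W t) y X) (nabla A a (lineVelocity W) y X) 0 :=
  ((h.mdifferentiableAt hV hy).2 X).add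
    (((infActL (A.form a y X)).restrictScalars ℝ).hasFDerivAt.comp_hasDerivAt 0
      (h.hasDerivAt hV hy))

lemma nabla_lineVelocity (h : IsVariation V w v W) (hV : IsOpen V) {y : Y} (hy : y ∈ V)
    (hwV : ∀ z ∈ V, w z ≠ 0) (hw : MDifferentiableAt 𝓘(ℝ, E3) 𝓘(ℝ, TSpinor) w y)
    (hv : MDifferentiableAt 𝓘(ℝ, E3) 𝓘(ℝ, TSpinor) v y) (X : TangentSpace 𝓘(ℝ, E3) y) :
    nabla A a (lineVelocity W) y X = nabla A a v y X +
      (dirDeriv (orbitSpeed w W) y X) • Complex.I • w y +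
        orbitSpeed w W y • Complex.I • nabla A a w y X := by
  have h1 : lineVelocity W =ᶠ[nhds y] fun z => v z + orbitSpeed w W z • Complex.I • w z := by
    filter_upwards [hV.mem_nhds hy] with z hz
    exact h.lineVelocity_eq hV hz (hwV z hz)
  have h2 := mdifferentiableAt_orbitSpeed hw (hwV y hy) (h.mdifferentiableAt hV hy).1
  have h3 := (dirDeriv_I_smul hw).1
  rw [nabla_congr A a h1, nabla_add A a hv (dirDeriv_fun_smul h2 h3).1, nabla_smul A a h2 h3,
    nabla_I_smul A a hw]
  abel

lemma IsVariation.hasDerivAt_threeHalfFueter (h : IsVariation V w v W) (hV : IsOpen V) {y : Y}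
    (hy : y ∈ V) (hw : w y ∈ Wmu) :
    HasDerivAt (fun t => threeHalfFueter A a (W t) y)
      (fderiv ℝ calTProj (w y) (lineVelocity W y)
          (horDirac (w y) fun j => nabla A a w y (P.frame a j y)) +
        calTProj (w y) (∑ j, cliff j (fderiv ℝ horProj (w y) (lineVelocity W y)
            (nabla A a w y (P.frame a j y)) +
          horProj (w y) (nabla A a (lineVelocity W) y (P.frame a j y))))) 0 := by
  have h0 : W 0 y = w y := h.zero y hy
  have hn : nabla A a (W 0) y = nabla A a w y := nabla_congr A a (by
    filter_upwards [hV.mem_nhds hy] with z hz using h.zero z hz)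
  have h1 := h.hasDerivAt hV hy
  have h1 := hasDerivAt_calTProj_horDirac (h.hasDerivAt hV hy)
    (fun j => h.hasDerivAt_nabla A a hV hy (P.frame a j y)) (h0.symm ▸ hw.2.2)
  rw [h0, hn] at h1
  refine h1.congr_of_eventuallyEq ?_
  filter_upwards [h.eventually_mem hy] with t ht
  exact threeHalfFueter_eq A a ht

lemma IsVariation.linearizationAlong_eq (h : IsVariation V w v W) (hV : IsOpen V) {y : Y}
    (hy : y ∈ V) (hwV : ∀ z ∈ V, w z ∈ Wmu)
    (hw : MDifferentiableAt 𝓘(ℝ, E3) 𝓘(ℝ, TSpinor) w y)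
    (hv : MDifferentiableAt 𝓘(ℝ, E3) 𝓘(ℝ, TSpinor) v y) :
    linearizationAlong A a W y = linearizedFueter A a w v y +
      zeroOrder (w y) (fun j => nabla A a w y (P.frame a j y)) (v y) := by
  have hwy := hwV y hy
  have h0 : W 0 y = w y := h.zero y hy
  have hn : nabla A a (W 0) y = nabla A a w y := nabla_congr A a (by
    filter_upwards [hV.mem_nhds hy] with z hz using h.zero z hz)
  have key := linearization_pointwise hwy (fun j => nabla A a w y (P.frame a j y))
    (fun j => nabla A a (lineVelocity W) y (P.frame a j y))
    (fun j => nabla A a v y (P.frame a j y))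
    (fun j => dirDeriv (orbitSpeed w W) y (P.frame a j y)) (orbitSpeed w W y) (v y)
    fun j => nabla_lineVelocity A a h hV hy (fun z hz => (hwV z hz).2.2) hw hv _
  -- The horizontal projection inside `leviCivita` is absorbed by `calTProj`, since 𝓣_w is contained
  -- in the horizontal space.
  rw [linearizedFueter_eq A a hwy, ← key, linearizationAlong, leviCivita,
    (h.hasDerivAt_threeHalfFueter A a hV hy hwy).deriv, threeHalfFueter_eq A a (h0 ▸ hwy), h0, hn,
    projT_eq hwy, projH_eq hwy.2.2, calTProj_horProj hwy,
    ← h.lineVelocity_eq hV hy hwy.2.2]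
  rfl

/-- The Leibniz rule, from which the principal symbol is read off. The Levi-Civita correction is
linear over functions, and `horProj` fixes v y because it is horizontal. -/
lemma linearizedFueter_smul {f : Y → ℝ} {y : Y} (hw : w y ∈ Wmu)
    (hf : MDifferentiableAt 𝓘(ℝ, E3) 𝓘(ℝ, ℝ) f y)
    (hv : MDifferentiableAt 𝓘(ℝ, E3) 𝓘(ℝ, TSpinor) v y) (hvy : v y ∈ horizontal (w y)) :
    linearizedFueter A a w (fun z => f z • v z) y = f y • linearizedFueter A a w v y +
      calTProj (w y) (∑ j, dirDeriv f y (P.frame a j y) • cliff j (v y)) := by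
  rw [linearizedFueter_eq A a hw, linearizedFueter_eq A a hw, ← map_smul, ← map_add,
    Finset.smul_sum, ← Finset.sum_add_distrib]
  refine congrArg _ (Finset.sum_congr rfl fun j _ => ?_)
  rw [nabla_smul A a hf hv, ← cliff_smul, ← cliff_smul, ← cliff_add]
  congr 1
  simp only [map_sub, map_add, map_smul, horProj_of_mem hvy, smul_I_comm, smul_sub]
  rw [smul_comm (_ / _ : ℝ) (f y)]
  abel

lemma zeroOrder_mem {w : TSpinor} (hw : w ∈ Wmu) (X : Fin 3 → TSpinor) (v : TSpinor) :
    zeroOrder w X v ∈ calT w := by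
  rw [zeroOrder, LinearMap.coe_mk, AddHom.coe_mk]
  exact calTProj_mem hw _

/-- The principal symbol of the linearized `3/2`-Fueter operator. -/
def symbol {w : TSpinor} (hw : w ∈ Wmu) {T : Type*} [AddCommGroup T] [Module ℝ T]
    [TopologicalSpace T] [IsTopologicalAddGroup T] [ContinuousSMul ℝ T] (e : Fin 3 → T) :
    (T →L[ℝ] ℝ) →ₗ[ℝ] tangentW0 w →ₗ[ℝ] calT w :=
  LinearMap.mk₂ ℝ
    (fun ξ v => ⟨calTProj w (∑ j, ξ (e j) • cliff j (v : TSpinor)), calTProj_mem hw _⟩)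
    (fun ξ η v => Subtype.ext <| by simp [add_smul, Finset.sum_add_distrib])
    (fun r ξ v => Subtype.ext <| by simp [mul_smul, Finset.smul_sum])
    (fun ξ v u => Subtype.ext <| by simp [cliff_add, Finset.sum_add_distrib])
    (fun r ξ v => Subtype.ext <| by simp [cliff_smul, Finset.smul_sum, smul_comm r])

lemma symbol_apply {w : TSpinor} (hw : w ∈ Wmu) {T : Type*} [AddCommGroup T] [Module ℝ T]
    [TopologicalSpace T] [IsTopologicalAddGroup T] [ContinuousSMul ℝ T] (e : Fin 3 → T)
    (ξ : T →L[ℝ] ℝ) (v : tangentW0 w) :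
    (symbol hw e ξ v : TSpinor) = calTProj w (∑ j, ξ (e j) • cliff j (v : TSpinor)) := rfl

end Manifold

end ThreeHalfFueter

end

open ThreeHalfFueter in
theorem mainTheorem2 {Y : Type*} [TopologicalSpace Y] [T2Space Y] [CompactSpace Y]
    [ChartedSpace E3 Y] [IsManifold 𝓘(ℝ, E3) ∞ Y]
    (g : Bundle.ContMDiffRiemannianMetric 𝓘(ℝ, E3) ∞ E3 (TangentSpace 𝓘(ℝ, E3) : Y → Type _))
    {ι : Type*} (P : SpinCStructure g ι) (A : PrincipalConnection P) (φ : SectionW0 P)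
    (a : ι) (V : Set Y) (hV : V ⊆ P.U a) (w : Y → TSpinor) (hw : IsLift (φ.toFun a) V w)
    (y : Y) (hy : y ∈ V) :
    Module.finrank ℝ (tangentW0 (w y)) < Module.finrank ℝ (calT (w y)) ∧
    ∃ σ : (TangentSpace 𝓘(ℝ, E3) y →L[ℝ] ℝ) →ₗ[ℝ] tangentW0 (w y) →ₗ[ℝ] calT (w y),
      (∀ (f : Y → ℝ) (v : Y → TSpinor), ContMDiffOn 𝓘(ℝ, E3) 𝓘(ℝ, ℝ) ∞ f V →
        ∀ hv : IsVerticalSection V w v,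
          linearizedFueter A a w (fun z => f z • v z) y =
            f y • linearizedFueter A a w v y +
              (σ (mfderiv 𝓘(ℝ, E3) 𝓘(ℝ, ℝ) f y) ⟨v y, hv.mem y hy⟩ : TSpinor)) ∧
      (∃ B : tangentW0 (w y) →ₗ[ℝ] calT (w y), ∀ (v : Y → TSpinor)
        (hv : IsVerticalSection V w v) (W : ℝ → Y → TSpinor), IsVariation V w v W →
          DifferentiableAt ℝ (fun t => threeHalfFueter A a (W t) y) 0 ∧
          linearizationAlong A a W y =
            linearizedFueter A a w v y + (B ⟨v y, hv.mem y hy⟩ : TSpinor)) ∧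
      ∀ ξ : TangentSpace 𝓘(ℝ, E3) y →L[ℝ] ℝ, ξ ≠ 0 → Function.Injective (σ ξ) := by
  have hwy : w y ∈ Wmu := hw.mem y hy
  have hd : ∀ {G : Type} [NormedAddCommGroup G] [NormedSpace ℝ G] {f : Y → G},
      ContMDiffOn 𝓘(ℝ, E3) 𝓘(ℝ, G) ∞ f V → MDifferentiableAt 𝓘(ℝ, E3) 𝓘(ℝ, G) f y :=
    fun hf => (hf.contMDiffAt (hw.isOpen.mem_nhds hy)).mdifferentiableAt (by simp)
  refine ⟨Submodule.finrank_lt_finrank_of_lt (tangentW0_lt_calT hwy),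
    symbol hwy fun j => P.frame a j y, fun f v hf hv => ?_,
    -- The zero order term depends only on the 1-jet of w at y, so one linear map serves all v and
    -- all families.
    ⟨(zeroOrder (w y) fun j => nabla A a w y (P.frame a j y)).restrict
      fun u _ => zeroOrder_mem hwy _ u, fun v hv W hW => ⟨?_, ?_⟩⟩,
    fun ξ hξ => ?_⟩
  · have hf' := hd hf
    have hv' := hd hv.smooth
    have hvy : v y ∈ horizontal (w y) := tangentW0_le_horizontal _ (hv.mem y hy)
    have h1 := linearizedFueter_smul A a hwy hf' hv' hvy
    refine h1.trans (congrArg _ ?_)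
    exact (symbol_apply hwy (fun j => P.frame a j y) (mfderiv 𝓘(ℝ, E3) 𝓘(ℝ, ℝ) f y)
      ⟨v y, hv.mem y hy⟩).symm
  · exact (hW.hasDerivAt_threeHalfFueter A a hw.isOpen hy hwy).differentiableAt
  · have hw' := hd hw.smooth
    have hv' := hd hv.smooth
    have h1 := hW.linearizationAlong_eq A a hw.isOpen hy hw.mem hw' hv'
    rw [h1, LinearMap.restrict_apply]
  · rw [injective_iff_map_eq_zero]
    intro v hv
    exact Subtype.ext (symbol_injective v.2 (frame_ne_zero a (hV hy) hξ) (congrArg Subtype.val hv))
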